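/- Let $\alpha,a,b,c>0$, let $V\in C^2(\mathbb R^d)$ with $\int_{\mathbb R^{2d}} e^{-\alpha V(q)-\frac{\alpha}{2}|p|^2}\,dq\,dp<\infty$, and let $\pi(q,p)=Z^{-1}e^{-\alpha V(q)-\frac{\alpha}{2}|p|^2}$ be the normalized Gibbs density on $\mathbb R^{2d}$, $x=(q,p)$; write $\mathbb E_\pi$ for integration against $\pi$. Let $\Gamma$ be a $C^1$ function of $q\in\mathbb R^d$ whose values are symmetric invertible $d\times d$ matrices (not necessarily positive definite), such that $$S(q)=\begin{bmatrix} b\,\Gamma^{-2} & a\,\Gamma^{-1}\\ a\,\Gamma^{-1} & c\,I\end{bmatrix}$$ is positive semidefinite for all $q$. Let $\rho_t\ge 0$, for $t$ in an open set $I\subseteq\mathbb R$, be a classical solution of the Fokker–Planck equation of $dq=p\,dt$, $dp=-\nabla V(q)\,dt-\Gamma(q)p\,dt+\sqrt{2\alpha^{-1}\Gamma(q)}\,dW$, i.e. of $$\partial_t\rho_t=-\nabla_q\cdot(\rho_t\,p)+\nabla_p\cdot\big(\rho_t\nabla V+\rho_t\Gamma p+\alpha^{-1}\Gamma\nabla_p\rho_t\big),$$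 and put $h=h_t=\rho_t/\pi$. Assume that $h_t$ is regular and controlled in the following sense: each $h_t$ is $C^3$ in $x$, its $x$-derivatives of order at most $3$ are jointly continuous in $(t,x)$, and every $t_0\in I$ has a neighbourhood on which these derivatives are bounded in norm by one function $g(x)$ such that $w\,g\in L^2(\pi)$, where $$w(q,p)=\big(1+|p|+|\nabla V|+|\mathrm{Hess}\,V|\big)\big(1+|\Gamma|+|\Gamma^{-1}|+|\partial\Gamma|\big)^2$$ (with $V$, $\Gamma$ and their derivatives evaluated at $q$, and the vectors and arrays other than $p$ measured by the sum of the absolute values of their entries). Let $\mathcal L(\rho_t)=\chi^2(\rho_t\,\|\,\pi)+\mathbb E_\pi\langle\nabla_x h,S\nabla_x h\rangle$, where $\chi^2(\mu\|\nu)=\int(\frac{d\mu}{d\nu}-1)^2\,d\nu$. Then for every $t\in I$ the integrals in $\mathcal L(\rho_t)$ converge, $s\mapsto \mathcal L(\rho_s)$ is differentiable at $t$, and $$\begin{aligned}\frac{d\mathcal L(\rho_t)}{dt}=-2\,\mathbb E_\pi\Big\{&\big\langle\nabla_p h,(\alpha^{-1}\Gamma+c\,\Gamma-a\Gamma^{-1}\mathrm{Hess}\,V)\nabla_p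 h\big\rangle+\big\langle\nabla_q h,a\Gamma^{-1}\nabla_q h\big\rangle\\&+\big\langle\nabla_p h,(a\Gamma^{-1}\Gamma+c\,I-\mathrm{Hess}\,V\; b\Gamma^{-2})\nabla_q h\big\rangle+\alpha^{-1}\big\langle SA,\nabla_p\nabla_x h\big\rangle_F\\&+\alpha^{-1}\big\langle\nabla_p\nabla_x h\cdot\Gamma,\,S\,\nabla_p\nabla_x h\big\rangle_F+\alpha^{-1}\big\langle B,\nabla_p\nabla_x h\big\rangle_F\Big\},\end{aligned}$$ where the integrand on the right is $\pi$-integrable. Here $\nabla_p\nabla_x h$ is the $2d\times d$ matrix with entries $\partial^2h/\partial x_i\partial p_j$, $\langle\cdot,\cdot\rangle_F$ is the Frobenius inner product, $A$ is the $2d\times d$ matrix whose $i$-th row is $(\frac{\partial\Gamma}{\partial x_i}\nabla_p h)^\top$, and $B$ is the $2d\times d$ matrix with entries $B_{ij}=-\sum_k\frac{\partial S_{ik}}{\partial q_j}\frac{\partial h}{\partial x_k}$. If $\Gamma(q)$ commutes with $\mathrm{Hess}\,V(q)$ for every $q$ (in particular if $\Gamma=s\sqrt{\mathrm{Hess}\,V}$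 with $s>0$), the formula also holds with $b\Gamma^{-2}\,\mathrm{Hess}\,V$ in place of $\mathrm{Hess}\,V\;b\Gamma^{-2}$. If $\Gamma$ is constant, then $A=0$ and $B=0$. -/

import Mathlib

open MeasureTheory Filter Topology Matrix

noncomputable section

namespace KineticLangevin

/-- Position space. -/
abbrev Pos (d : ℕ) : Type := EuclideanSpace ℝ (Fin d)

/-- Phase space of the variables `x = (q, p)`: the index `Sum.inl i` is the coordinate `q_i`, the
index `Sum.inr i` is the coordinate `p_i`. -/
abbrev Phase (d : ℕ) : Type := EuclideanSpace ℝ (Fin d ⊕ Fin d)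

/-- The position part `q` of `x = (q, p)`. -/
def pos {d : ℕ} (x : Phase d) : Pos d := WithLp.toLp 2 fun i => x (Sum.inl i)

/-- The momentum part `p` of `x = (q, p)`. -/
def mom {d : ℕ} (x : Phase d) : Pos d := WithLp.toLp 2 fun i => x (Sum.inr i)

/-- The partial derivative `∂f/∂x_i` at `x`. -/
def pderiv {ι : Type} [Fintype ι] [DecidableEq ι] (i : ι) (f : EuclideanSpace ℝ ι → ℝ)
    (x : EuclideanSpace ℝ ι) : ℝ :=
  fderiv ℝ f x (EuclideanSpace.single i 1)

/-- The gradient, as a vector of partial derivatives. -/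
def grad {ι : Type} [Fintype ι] [DecidableEq ι] (f : EuclideanSpace ℝ ι → ℝ)
    (x : EuclideanSpace ℝ ι) : ι → ℝ :=
  fun i => pderiv i f x

/-- The gradient in the position variables. -/
def gradQ {d : ℕ} (f : Phase d → ℝ) (x : Phase d) : Fin d → ℝ :=
  fun i => pderiv (Sum.inl i) f x

/-- The gradient in the momentum variables. -/
def gradP {d : ℕ} (f : Phase d → ℝ) (x : Phase d) : Fin d → ℝ :=
  fun i => pderiv (Sum.inr i) f x

/-- The Hessian matrix of the potential. -/
def hess {d : ℕ} (V : Pos d → ℝ) (q : Pos d) : Matrix (Fin d) (Fin d) ℝ :=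
  Matrix.of fun i j => pderiv i (pderiv j V) q

/-- The mixed second derivatives `∇_p ∇_x h`, a `2d × d` matrix with entries
`∂²h / ∂x_i ∂p_j`. -/
def hessPX {d : ℕ} (h : Phase d → ℝ) (x : Phase d) : Matrix (Fin d ⊕ Fin d) (Fin d) ℝ :=
  Matrix.of fun i j => pderiv (Sum.inr j) (pderiv i h) x

/-- The Frobenius inner product of real matrices. -/
def frob {m n : Type} [Fintype m] [Fintype n] (M N : Matrix m n ℝ) : ℝ :=
  ∑ i, ∑ j, M i j * N i j

/-- The unnormalized Gibbs density `exp (-α V(q) - (α/2) |p|²)`. -/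
def gibbsWeight {d : ℕ} (α : ℝ) (V : Pos d → ℝ) (x : Phase d) : ℝ :=
  Real.exp (-α * V (pos x) - α / 2 * ‖mom x‖ ^ 2)

/-- The normalized Gibbs density. -/
def gibbsDensity {d : ℕ} (α : ℝ) (V : Pos d → ℝ) (x : Phase d) : ℝ :=
  (∫ y, gibbsWeight α V y)⁻¹ * gibbsWeight α V x

/-- The measure with a given density with respect to Lebesgue measure on phase space. -/
def lawOf {d : ℕ} (ρ : Phase d → ℝ) : Measure (Phase d) :=
  volume.withDensity fun x => ENNReal.ofReal (ρ x)

/-- The Gibbs measure `π`. -/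
def gibbs {d : ℕ} (α : ℝ) (V : Pos d → ℝ) : Measure (Phase d) :=
  lawOf (gibbsDensity α V)

/-- The relative density `h = ρ / π`. -/
def relDensity {d : ℕ} (α : ℝ) (V : Pos d → ℝ) (ρ : Phase d → ℝ) (x : Phase d) : ℝ :=
  ρ x / gibbsDensity α V x

/-- The probability flux `ρ J` of the dynamics
`dq = p dt`, `dp = -∇V(q) dt - Γ(q) p dt + √(2 α⁻¹ Γ(q)) dW`, that is
`ρ J = (ρ p, -ρ ∇V - ρ Γ p - α⁻¹ Γ ∇_p ρ)`. -/
def flux {d : ℕ} (α : ℝ) (V : Pos d → ℝ) (Γ : Pos d → Matrix (Fin d) (Fin d) ℝ)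
    (ρ : Phase d → ℝ) (x : Phase d) : Fin d ⊕ Fin d → ℝ :=
  Sum.elim
    (fun i => ρ x * mom x i)
    (fun i => -(ρ x * pderiv i V (pos x)) - ρ x * (Γ (pos x) *ᵥ (mom x).ofLp) i
      - α⁻¹ * (Γ (pos x) *ᵥ gradP ρ x) i)

/-- `ρ` satisfies the Fokker-Planck equation `∂ρ/∂t + ∇_x · (ρ J) = 0` at every time in `I`. -/
def SolvesFokkerPlanck {d : ℕ} (α : ℝ) (V : Pos d → ℝ) (Γ : Pos d → Matrix (Fin d) (Fin d) ℝ)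
    (I : Set ℝ) (ρ : ℝ → Phase d → ℝ) : Prop :=
  ∀ t ∈ I, ∀ x, HasDerivAt (fun s => ρ s x)
    (-∑ i, pderiv i (fun y => flux α V Γ (ρ t) y i) x) t

/-- The size of the coefficients of the equation:
`(1 + |p| + |∇V| + |Hess V|) (1 + |Γ| + |Γ⁻¹| + |∂Γ|)²`. -/
def coeffSize {d : ℕ} (V : Pos d → ℝ) (Γ : Pos d → Matrix (Fin d) (Fin d) ℝ) (x : Phase d) : ℝ :=
  (1 + ‖mom x‖ + ∑ i, |pderiv i V (pos x)| + ∑ i, ∑ j, |hess V (pos x) i j|) *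
    (1 + ∑ i, ∑ j, |Γ (pos x) i j| + ∑ i, ∑ j, |(Γ (pos x))⁻¹ i j|
      + ∑ i, ∑ j, ∑ k, |pderiv k (fun q => Γ q i j) (pos x)|) ^ 2

/-- The regularity class of a family `h t`, `t ∈ I`, of functions on phase space. Each `h t` is
`C³`, its derivatives of order at most three are jointly continuous in time and space, and near each
time in `I` they are bounded by one function `g` such that `coeffSize * g` is in `L²(π)`. -/
structure IsRegularFamily {d : ℕ} (α : ℝ) (V : Pos d → ℝ)
    (Γ : Pos d → Matrix (Fin d) (Fin d) ℝ) (I : Set ℝ) (h : ℝ → Phase d → ℝ) : Prop where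
  contDiff : ∀ t ∈ I, ContDiff ℝ 3 (h t)
  continuousOn : ∀ k ≤ 3,
    ContinuousOn (fun z : ℝ × Phase d => iteratedFDeriv ℝ k (h z.1) z.2) (I ×ˢ Set.univ)
  dominated : ∀ t₀ ∈ I, ∃ g : Phase d → ℝ,
    MemLp (fun x => coeffSize V Γ x * g x) 2 (gibbs α V) ∧
    ∀ᶠ t in 𝓝 t₀, ∀ k ≤ 3, ∀ x, ‖iteratedFDeriv ℝ k (h t) x‖ ≤ g x

/-- The `χ²`-divergence of `μ` from `ν`. -/
def chiSqDiv {X : Type} [MeasurableSpace X] (μ ν : Measure X) : ℝ :=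
  ∫ x, ((μ.rnDeriv ν x).toReal - 1) ^ 2 ∂ν

/-- The block matrix `S = [[b Γ⁻², a Γ⁻¹], [a Γ⁻¹, c I]]`. -/
def matS {d : ℕ} (a b c : ℝ) (Γ : Pos d → Matrix (Fin d) (Fin d) ℝ) (q : Pos d) :
    Matrix (Fin d ⊕ Fin d) (Fin d ⊕ Fin d) ℝ :=
  Matrix.fromBlocks (b • ((Γ q)⁻¹ * (Γ q)⁻¹)) (a • (Γ q)⁻¹) (a • (Γ q)⁻¹) (c • 1)

/-- The Lyapunov functional `χ²(ρ ‖ π) + E_π ⟨∇_x h, S ∇_x h⟩`, where `h = ρ / π`. -/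
def lyapunov {d : ℕ} (α a b c : ℝ) (V : Pos d → ℝ) (Γ : Pos d → Matrix (Fin d) (Fin d) ℝ)
    (ρ : Phase d → ℝ) : ℝ :=
  chiSqDiv (lawOf ρ) (gibbs α V) +
    ∫ x, grad (relDensity α V ρ) x ⬝ᵥ (matS a b c Γ (pos x) *ᵥ grad (relDensity α V ρ) x)
      ∂(gibbs α V)

/-- The matrix `∂Γ/∂x_i`, with `Γ` regarded as a function of `x = (q, p)`. -/
def dGamma {d : ℕ} (Γ : Pos d → Matrix (Fin d) (Fin d) ℝ) (i : Fin d ⊕ Fin d) (x : Phase d) :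
    Matrix (Fin d) (Fin d) ℝ :=
  Matrix.of fun j k => pderiv i (fun y : Phase d => Γ (pos y) j k) x

/-- The `2d × d` matrix `A` whose `i`-th row is `((∂Γ/∂x_i) ∇_p h)ᵀ`. -/
def matA {d : ℕ} (Γ : Pos d → Matrix (Fin d) (Fin d) ℝ) (h : Phase d → ℝ) (x : Phase d) :
    Matrix (Fin d ⊕ Fin d) (Fin d) ℝ :=
  Matrix.of fun i => dGamma Γ i x *ᵥ gradP h x

/-- The `2d × d` matrix `B` with entries `-∑ k, (∂S_ik/∂q_j) (∂h/∂x_k)`. -/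
def matB {d : ℕ} (a b c : ℝ) (Γ : Pos d → Matrix (Fin d) (Fin d) ℝ) (h : Phase d → ℝ)
    (x : Phase d) : Matrix (Fin d ⊕ Fin d) (Fin d) ℝ :=
  Matrix.of fun i j =>
    -∑ k, pderiv (Sum.inl j) (fun y : Phase d => matS a b c Γ (pos y) i k) x * pderiv k h x

/-- The integrand of the formula for the time derivative of the Lyapunov functional. The argument
`K` is the product of `b Γ⁻²` and `Hess V` in the mixed term. -/
def rateIntegrand {d : ℕ} (α a b c : ℝ) (V : Pos d → ℝ) (Γ K : Pos d → Matrix (Fin d) (Fin d) ℝ)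
    (h : Phase d → ℝ) (x : Phase d) : ℝ :=
  gradP h x ⬝ᵥ ((α⁻¹ • Γ (pos x) + c • Γ (pos x) - (a • (Γ (pos x))⁻¹) * hess V (pos x))
      *ᵥ gradP h x)
    + gradQ h x ⬝ᵥ ((a • (Γ (pos x))⁻¹) *ᵥ gradQ h x)
    + gradP h x ⬝ᵥ (((a • (Γ (pos x))⁻¹) * Γ (pos x) + c • 1 - K (pos x)) *ᵥ gradQ h x)
    + α⁻¹ * frob (matS a b c Γ (pos x) * matA Γ h x) (hessPX h x)
    + α⁻¹ * frob (hessPX h x * Γ (pos x)) (matS a b c Γ (pos x) * hessPX h x)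
    + α⁻¹ * frob (matB a b c Γ h x) (hessPX h x)

end KineticLangevin

end

set_option linter.unusedSectionVars false

/-! Write D_i = ∂/∂p_i - α p_i and T = -p·∇_q + ∇V·∇_p. Dividing the Fokker–Planck equation by π
turns it into ∂_t h = L h with L = T + α⁻¹ ∑ Γ_ij D_i ∂_{p_j} (`hasDerivAt_relDensity`). Two facts
replace every integration by parts: T F has zero integral against π, because the Hamiltonian flow
preserves π (`isNullFun_transport`), and so has φ D_i F when φ does not depend on p_i, because -D_i
is the adjoint of ∂_{p_i} in L²(π) (`isNullFun_divP`).

Differentiating L h in x_k gives L ∂_k h, a term with ∂_kΓ, and a first-order commutator C_k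
(`hasPDerivAt_gen`). The gradient of h is not assumed differentiable in time; the equation and the
joint continuity of ∂_k L h give this (`hasDerivAt_pderiv_of_continuousAt`). Differentiation under
the integral then expresses the derivative of the functional as an integral involving h, L h, the
∂_k h and the ∂_k L h.

The core is `isNullFun_rate`: this integrand plus twice the claimed rate is, pointwise, a
combination of functions T F and φ D_i F. The terms of the rate arise as follows. The Leibniz rule
for D_i in the χ² part gives α⁻¹Γ. The pairing of C with S∇h gives the remaining terms that are
quadratic in ∇h (`commutator_identity`). The second-order part of L gives the term quadratic in
∇_p∇_x h, and ∂_kΓ gives A. Moving T across S leaves p·∂_q S, whose factor p_j is traded for α⁻¹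
∂_{p_j}; this gives B (`gradient_part_identity`).

All integrability reduces to counting powers. With u = 1+|p|+|∇V|+|Hess V| and v = 1+|Γ|+|Γ⁻¹|+|∂Γ|,
the hypothesis u v² g ∈ L²(π) makes u² v⁴ g² integrable, and every expression quadratic in h stays
below this bound (`GrowthBound`). Expressions linear in h, which come from the -1 in h - 1, are
handled by L² bounds and the finiteness of π. -/

namespace KineticLangevin

/-! ### Partial derivatives along coordinate lines, and their interchange with time derivatives. -/

section Calculus

variable {ι : Type} [Fintype ι] [DecidableEq ι]

/-- `f` has partial derivative `f'` in the `i`-th coordinate at `x`. -/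
def HasPDerivAt (i : ι) (f : EuclideanSpace ℝ ι → ℝ) (f' : ℝ) (x : EuclideanSpace ℝ ι) : Prop :=
  HasLineDerivAt ℝ f f' x (EuclideanSpace.single i 1)

theorem HasPDerivAt.of_differentiable {f : EuclideanSpace ℝ ι → ℝ} {x : EuclideanSpace ℝ ι}
    (hf : DifferentiableAt ℝ f x) (i : ι) : HasPDerivAt i f (pderiv i f x) x :=
  hf.hasFDerivAt.hasLineDerivAt _

theorem HasPDerivAt.pderiv_eq {f : EuclideanSpace ℝ ι → ℝ} {f' : ℝ} {x : EuclideanSpace ℝ ι} {i : ι}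
    (h : HasPDerivAt i f f' x) (hf : DifferentiableAt ℝ f x) : pderiv i f x = f' :=
  HasLineDerivAt.unique (HasPDerivAt.of_differentiable hf i) h

theorem HasPDerivAt.const (i : ι) (r : ℝ) (x : EuclideanSpace ℝ ι) :
    HasPDerivAt i (fun _ => r) 0 x :=
  hasDerivAt_const _ _

theorem HasPDerivAt.add {f g : EuclideanSpace ℝ ι → ℝ} {f' g' : ℝ} {x : EuclideanSpace ℝ ι} {i : ι}
    (hf : HasPDerivAt i f f' x) (hg : HasPDerivAt i g g' x) :
    HasPDerivAt i (fun y => f y + g y) (f' + g') x :=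
  HasDerivAt.add hf hg

theorem HasPDerivAt.sub {f g : EuclideanSpace ℝ ι → ℝ} {f' g' : ℝ} {x : EuclideanSpace ℝ ι} {i : ι}
    (hf : HasPDerivAt i f f' x) (hg : HasPDerivAt i g g' x) :
    HasPDerivAt i (fun y => f y - g y) (f' - g') x :=
  HasDerivAt.sub hf hg

theorem HasPDerivAt.neg {f : EuclideanSpace ℝ ι → ℝ} {f' : ℝ} {x : EuclideanSpace ℝ ι} {i : ι}
    (hf : HasPDerivAt i f f' x) : HasPDerivAt i (fun y => -f y) (-f') x :=
  HasDerivAt.neg hf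

theorem HasPDerivAt.mul {f g : EuclideanSpace ℝ ι → ℝ} {f' g' : ℝ} {x : EuclideanSpace ℝ ι} {i : ι}
    (hf : HasPDerivAt i f f' x) (hg : HasPDerivAt i g g' x) :
    HasPDerivAt i (fun y => f y * g y) (f' * g x + f x * g') x := by
  have := HasDerivAt.mul hf hg
  simpa [HasPDerivAt, HasLineDerivAt, Pi.mul_def] using this

theorem HasPDerivAt.const_mul {f : EuclideanSpace ℝ ι → ℝ} {f' : ℝ} {x : EuclideanSpace ℝ ι} {i : ι}
    (r : ℝ) (hf : HasPDerivAt i f f' x) : HasPDerivAt i (fun y => r * f y) (r * f') x :=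
  HasDerivAt.const_mul r hf

theorem HasPDerivAt.sum {κ : Type*} {s : Finset κ} {f : κ → EuclideanSpace ℝ ι → ℝ} {f' : κ → ℝ}
    {x : EuclideanSpace ℝ ι} {i : ι} (hf : ∀ k ∈ s, HasPDerivAt i (f k) (f' k) x) :
    HasPDerivAt i (fun y => ∑ k ∈ s, f k y) (∑ k ∈ s, f' k) x :=
  HasDerivAt.fun_sum hf

theorem HasPDerivAt.congr_deriv {f : EuclideanSpace ℝ ι → ℝ} {f' f'' : ℝ}
    {x : EuclideanSpace ℝ ι} {i : ι} (hf : HasPDerivAt i f f' x) (h : f' = f'') :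
    HasPDerivAt i f f'' x := h ▸ hf

theorem HasPDerivAt.hasDerivAt_line {f : EuclideanSpace ℝ ι → ℝ} {f' : ℝ} {x : EuclideanSpace ℝ ι}
    {i : ι} {y : ℝ} (hf : HasPDerivAt i f f' (x + y • EuclideanSpace.single i (1 : ℝ))) :
    HasDerivAt (fun r : ℝ => f (x + r • EuclideanSpace.single i (1 : ℝ))) f' y := by
  have h1 : HasDerivAt (fun r : ℝ => f (x + y • EuclideanSpace.single i (1 : ℝ)
      + r • EuclideanSpace.single i (1 : ℝ))) f' (y - y) := by
    rw [sub_self]; exact hf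
  have h2 := h1.comp_sub_const y y
  refine h2.congr_of_eventuallyEq (Eventually.of_forall fun r => ?_)
  simp only [add_assoc, ← add_smul, add_sub_cancel]

/-- Interchange of a time derivative and a partial derivative. -/
theorem hasDerivAt_pderiv_of_continuousAt {f ψ ψ' : ℝ → EuclideanSpace ℝ ι → ℝ}
    {fi : ℝ → EuclideanSpace ℝ ι → ℝ} {i : ι} {J : Set ℝ} (hJ : IsOpen J) {t : ℝ} (ht : t ∈ J)
    {x : EuclideanSpace ℝ ι}
    (hf : ∀ s ∈ J, ∀ y, HasDerivAt (fun r => f r y) (ψ s y) s)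
    (hfi : ∀ s ∈ J, HasPDerivAt i (f s) (fi s x) x)
    (hψ : ∀ s ∈ J, ∀ y, HasPDerivAt i (ψ s) (ψ' s y) y)
    (hc : ContinuousAt (fun z : ℝ × EuclideanSpace ℝ ι => ψ' z.1 z.2) (t, x)) :
    HasDerivAt (fun s => fi s x) (ψ' t x) t := by
  set e : EuclideanSpace ℝ ι := EuclideanSpace.single i 1 with he
  set c := ψ' t x with hcdef
  rw [hasDerivAt_iff_isLittleO, Asymptotics.isLittleO_iff]
  intro ε hε
  have hc2 : ContinuousAt (fun z : ℝ × ℝ => ψ' z.1 (x + z.2 • e)) (t, 0) := by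
    have h1 : ContinuousAt (fun z : ℝ × ℝ => (z.1, x + z.2 • e)) (t, 0) := by fun_prop
    exact ContinuousAt.comp (f := fun z : ℝ × ℝ => (z.1, x + z.2 • e))
      (g := fun z : ℝ × EuclideanSpace ℝ ι => ψ' z.1 z.2) (by simpa using hc) h1
  have hev : ∀ᶠ z : ℝ × ℝ in 𝓝 (t, 0), ‖ψ' z.1 (x + z.2 • e) - c‖ ≤ ε := by
    have := Metric.tendsto_nhds.1 hc2 ε hε
    filter_upwards [this] with z hz
    simp only [zero_smul, add_zero] at hz
    rw [dist_eq_norm] at hz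
    exact hz.le
  rw [nhds_prod_eq] at hev
  obtain ⟨δ1, hδ1, δ2, hδ2, hb⟩ : ∃ δ1 > 0, ∃ δ2 > 0, Metric.ball t δ1 ⊆ J ∧
      ∀ s ∈ Metric.ball t δ1, ∀ y ∈ Metric.ball (0 : ℝ) δ2, ‖ψ' s (x + y • e) - c‖ ≤ ε := by
    obtain ⟨pa, hpa, pb, hpb, hp⟩ := Filter.eventually_prod_iff.1 hev
    obtain ⟨a1, ha1, h1⟩ := Metric.mem_nhds_iff.1 (inter_mem hpa (hJ.mem_nhds ht))
    obtain ⟨a2, ha2, h2⟩ := Metric.mem_nhds_iff.1 hpb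
    exact ⟨a1, ha1, a2, ha2, fun s hs => (h1 hs).2, fun s hs y hy => hp (h1 hs).1 (h2 hy)⟩
  obtain ⟨hbJ, hb⟩ := hb
  filter_upwards [Metric.ball_mem_nhds t hδ1] with s hs
  -- Mean value inequality twice, first in space for ψ and then in time for f: a mixed second
  -- difference of f differs from (s - t) y c by at most ε |y| |s - t|, uniformly near (t, 0).
  have key : ∀ y ∈ Metric.ball (0 : ℝ) δ2,
      ‖(f s (x + y • e) - f s x) - (f t (x + y • e) - f t x) - (s - t) * (y * c)‖
        ≤ ε * ‖y‖ * ‖s - t‖ := by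
    intro y hy
    have hd : ∀ r ∈ Metric.ball t δ1, HasDerivWithinAt
        (fun r => f r (x + y • e) - f r x - r * (y * c)) (ψ r (x + y • e) - ψ r x - y * c)
        (Metric.ball t δ1) r := by
      intro r hr
      have h3 : HasDerivAt (fun r : ℝ => r * (y * c)) (y * c) r := by
        simpa using (hasDerivAt_id r).mul_const (y * c)
      exact (((hf r (hbJ hr) _).sub (hf r (hbJ hr) _)).sub h3).hasDerivWithinAt
    have hbd : ∀ r ∈ Metric.ball t δ1, ‖ψ r (x + y • e) - ψ r x - y * c‖ ≤ ε * ‖y‖ := by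
      intro r hr
      have hd2 : ∀ z ∈ Metric.ball (0 : ℝ) δ2, HasDerivWithinAt
          (fun z => ψ r (x + z • e) - z * c) (ψ' r (x + z • e) - c)
          (Metric.ball (0 : ℝ) δ2) z := by
        intro z hz
        have h3 : HasDerivAt (fun r : ℝ => r * c) c z := by
          simpa using (hasDerivAt_id z).mul_const c
        exact ((hψ r (hbJ hr) _).hasDerivAt_line.sub h3).hasDerivWithinAt
      have := (convex_ball (0 : ℝ) δ2).norm_image_sub_le_of_norm_hasDerivWithin_le hd2
        (fun z hz => hb r hr z hz) (Metric.mem_ball_self hδ2) hy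
      simp only [zero_smul, add_zero, zero_mul, sub_zero] at this
      convert! this using 2
      ring
    have := (convex_ball t δ1).norm_image_sub_le_of_norm_hasDerivWithin_le hd hbd
      (Metric.mem_ball_self hδ1) hs
    convert! this using 2
    ring
  -- Divide `key` by |y| and let y → 0 at fixed s. The bound survives the limit and is the little-o
  -- estimate at t.
  have hlim : Tendsto (fun y : ℝ => ‖y⁻¹ * (f s (x + y • e) - f s x)
      - y⁻¹ * (f t (x + y • e) - f t x) - (s - t) * c‖) (𝓝[≠] 0)
      (𝓝 ‖fi s x - fi t x - (s - t) * c‖) := by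
    have h1 := hasLineDerivAt_iff_tendsto_slope_zero.1 (hfi s (hbJ hs))
    have h2 := hasLineDerivAt_iff_tendsto_slope_zero.1 (hfi t ht)
    simp only [smul_eq_mul] at h1 h2
    exact ((h1.sub h2).sub_const _).norm
  have hle : ‖fi s x - fi t x - (s - t) * c‖ ≤ ε * ‖s - t‖ := by
    refine le_of_tendsto hlim ?_
    have hb0 : ∀ᶠ y : ℝ in 𝓝[≠] 0, y ∈ Metric.ball (0 : ℝ) δ2 :=
      nhdsWithin_le_nhds (Metric.ball_mem_nhds 0 hδ2)
    filter_upwards [hb0, self_mem_nhdsWithin] with y hy hy0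
    have hy0 : y ≠ 0 := hy0
    have h1 := key y hy
    have h2 : y⁻¹ * (f s (x + y • e) - f s x) - y⁻¹ * (f t (x + y • e) - f t x) - (s - t) * c
        = y⁻¹ * ((f s (x + y • e) - f s x) - (f t (x + y • e) - f t x) - (s - t) * (y * c)) := by
      field_simp
    rw [h2, norm_mul, norm_inv]
    have hyp : 0 < ‖y‖ := norm_pos_iff.2 hy0
    rw [inv_mul_le_iff₀ hyp]
    linarith
  simpa [smul_eq_mul] using hle

theorem pderiv_iteratedFDeriv {n : ℕ} {f : EuclideanSpace ℝ ι → ℝ} {x : EuclideanSpace ℝ ι}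
    (hf : ContDiffAt ℝ (n + 1 : ℕ) f x) (i : ι) (m : Fin n → EuclideanSpace ℝ ι) :
    pderiv i (fun y => iteratedFDeriv ℝ n f y m) x
      = iteratedFDeriv ℝ (n + 1) f x (Fin.cons (EuclideanSpace.single i 1) m) := by
  have hd : DifferentiableAt ℝ (iteratedFDeriv ℝ n f) x :=
    hf.differentiableAt_iteratedFDeriv (by exact_mod_cast Nat.lt_succ_self n)
  rw [iteratedFDeriv_succ_apply_left, pderiv, fderiv_continuousMultilinear_apply_const_apply hd]
  simp

theorem contDiff_pderiv {n : ℕ} {f : EuclideanSpace ℝ ι → ℝ} (hf : ContDiff ℝ (n + 1 : ℕ) f)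
    (i : ι) : ContDiff ℝ n (pderiv i f) :=
  (hf.fderiv_right (m := n) (by norm_cast)).clm_apply contDiff_const

theorem pderiv_comm {f : EuclideanSpace ℝ ι → ℝ} (hf : ContDiff ℝ 2 f) (i j : ι)
    (x : EuclideanSpace ℝ ι) : pderiv i (pderiv j f) x = pderiv j (pderiv i f) x := by
  have hd : DifferentiableAt ℝ (fderiv ℝ f) x :=
    (hf.fderiv_right (m := 1) (by norm_num)).differentiable (by norm_num) x
  have hs : IsSymmSndFDerivAt ℝ f x :=
    hf.contDiffAt.isSymmSndFDerivAt (by simp)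
  have h1 : ∀ i j : ι, pderiv i (pderiv j f) x
      = fderiv ℝ (fderiv ℝ f) x (EuclideanSpace.single i 1) (EuclideanSpace.single j 1) := by
    intro i j
    have : HasFDerivAt (pderiv j f) ((fderiv ℝ (fderiv ℝ f) x).flip (EuclideanSpace.single j 1)) x := by
      have := hd.hasFDerivAt.clm_apply (hasFDerivAt_const (EuclideanSpace.single j (1:ℝ)) x)
      convert! this using 1
      ext; simp
    simp [pderiv, this.fderiv]
  rw [h1, h1, hs.eq]

end Calculus

/-! ### The coordinates (q, p) and functions of q alone. -/

section PhaseSpace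

variable {d : ℕ}

theorem contDiff_pos {n : WithTop ℕ∞} : ContDiff ℝ n (pos : Phase d → Pos d) :=
  contDiff_euclidean.2 fun i => by simp only [pos]; fun_prop

theorem contDiff_mom {n : WithTop ℕ∞} : ContDiff ℝ n (mom : Phase d → Pos d) :=
  contDiff_euclidean.2 fun i => by simp only [mom]; fun_prop

theorem contDiff_mom_apply {n : WithTop ℕ∞} (i : Fin d) : ContDiff ℝ n (fun x : Phase d => mom x i) :=
  contDiff_euclidean.1 contDiff_mom i

theorem pos_add_smul_inl (x : Phase d) (s : ℝ) (i : Fin d) :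
    pos (x + s • EuclideanSpace.single (Sum.inl i) (1 : ℝ))
      = pos x + s • EuclideanSpace.single i (1 : ℝ) := by
  ext j
  simp [pos]

theorem pos_add_smul_inr (x : Phase d) (s : ℝ) (i : Fin d) :
    pos (x + s • EuclideanSpace.single (Sum.inr i) (1 : ℝ)) = pos x := by
  ext j
  simp [pos]

theorem HasPDerivAt.comp_pos_inl {f : Pos d → ℝ} {f' : ℝ} {x : Phase d} {i : Fin d}
    (h : HasPDerivAt i f f' (pos x)) : HasPDerivAt (Sum.inl i) (fun y : Phase d => f (pos y)) f' x := by
  unfold HasPDerivAt HasLineDerivAt at *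
  simpa only [pos_add_smul_inl] using h

theorem hasPDerivAt_comp_pos_inr (f : Pos d → ℝ) (x : Phase d) (i : Fin d) :
    HasPDerivAt (Sum.inr i) (fun y : Phase d => f (pos y)) 0 x := by
  unfold HasPDerivAt HasLineDerivAt
  simp only [pos_add_smul_inr]
  exact hasDerivAt_const _ _

theorem hasPDerivAt_mom (k : Fin d ⊕ Fin d) (j : Fin d) (x : Phase d) :
    HasPDerivAt k (fun y : Phase d => mom y j) (if k = Sum.inr j then 1 else 0) x := by
  unfold HasPDerivAt HasLineDerivAt
  have h1 : ∀ s : ℝ, mom (x + s • EuclideanSpace.single k (1 : ℝ)) j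
      = mom x j + s * (if k = Sum.inr j then 1 else 0) := by
    intro s
    simp [mom, eq_comm]
  simp only [h1]
  simpa using ((hasDerivAt_id (0 : ℝ)).mul_const (if k = Sum.inr j then (1 : ℝ) else 0)).const_add
    (mom x j)

theorem hasPDerivAt_comp_pos {f : Pos d → ℝ} (hf : Differentiable ℝ f) (k : Fin d ⊕ Fin d)
    (x : Phase d) : HasPDerivAt k (fun y : Phase d => f (pos y))
      (Sum.elim (fun i => pderiv i f (pos x)) (fun _ => 0) k) x := by
  rcases k with i | i
  · exact (HasPDerivAt.of_differentiable (hf _) i).comp_pos_inl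
  · exact hasPDerivAt_comp_pos_inr f x i

end PhaseSpace

/-! ### The Gibbs measure: logarithmic gradient, integration by parts, moments of p, relative
densities. -/

section Gibbs

variable {d : ℕ} {α : ℝ} {V : Pos d → ℝ}

/-- The gradient of the Hamiltonian `V(q) + |p|²/2`. -/
noncomputable def gradH (V : Pos d → ℝ) (k : Fin d ⊕ Fin d) (x : Phase d) : ℝ :=
  Sum.elim (fun i => pderiv i V (pos x)) (fun i => mom x i) k

theorem gibbsWeight_pos (x : Phase d) : 0 < gibbsWeight α V x := Real.exp_pos _

theorem contDiff_gibbsWeight {n : WithTop ℕ∞} (hV : ContDiff ℝ n V) : ContDiff ℝ n (gibbsWeight α V) := by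
  have h1 : ContDiff ℝ n (fun x : Phase d => V (pos x)) := hV.comp contDiff_pos
  have h2 : ContDiff ℝ n (fun x : Phase d => ‖mom x‖ ^ 2) := contDiff_mom.norm_sq ℝ
  exact ((contDiff_const.mul h1).sub (contDiff_const.mul h2)).exp

theorem partition_pos (hZ : Integrable (gibbsWeight α V)) : 0 < ∫ y, gibbsWeight α V y := by
  rw [integral_pos_iff_support_of_nonneg (fun x => (gibbsWeight_pos x).le) hZ]
  have : Function.support (gibbsWeight α V) = Set.univ := by
    ext x; simp [(gibbsWeight_pos x).ne']
  rw [this]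
  exact isOpen_univ.measure_pos _ Set.univ_nonempty

theorem gibbsDensity_pos (hZ : Integrable (gibbsWeight α V)) (x : Phase d) :
    0 < gibbsDensity α V x :=
  mul_pos (inv_pos.2 (partition_pos hZ)) (gibbsWeight_pos x)

theorem contDiff_gibbsDensity {n : WithTop ℕ∞} (hV : ContDiff ℝ n V) :
    ContDiff ℝ n (gibbsDensity α V) :=
  contDiff_const.mul (contDiff_gibbsWeight hV)

theorem hasPDerivAt_gibbsDensity (hV : Differentiable ℝ V) (k : Fin d ⊕ Fin d) (x : Phase d) :
    HasPDerivAt k (gibbsDensity α V) (-(α * gradH V k x) * gibbsDensity α V x) x := by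
  have h2 : HasPDerivAt k (fun y : Phase d => ‖mom y‖ ^ 2)
      (∑ j, 2 * (mom x j * if k = Sum.inr j then 1 else 0)) x := by
    have : (fun y : Phase d => ‖mom y‖ ^ 2) = fun y => ∑ j, mom y j * mom y j := by
      ext y; rw [EuclideanSpace.real_norm_sq_eq]; simp only [sq]
    rw [this]
    refine HasPDerivAt.sum fun j _ => ?_
    exact ((hasPDerivAt_mom k j x).mul (hasPDerivAt_mom k j x)).congr_deriv (by ring)
  have h3 : HasPDerivAt k (fun y : Phase d => -α * V (pos y) - α / 2 * ‖mom y‖ ^ 2)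
      (-(α * gradH V k x)) x := by
    refine (((hasPDerivAt_comp_pos hV k x).const_mul (-α)).sub (h2.const_mul (α / 2))).congr_deriv ?_
    rcases k with i | i
    · simp [gradH]
    · simp [gradH]
      ring
  have h4 := (HasDerivAt.exp h3).const_mul (∫ y, gibbsWeight α V y)⁻¹
  simp only [zero_smul, add_zero] at h4
  refine HasDerivAt.congr_deriv h4 ?_
  simp only [gibbsDensity, gibbsWeight]
  ring

theorem integrable_gibbs_iff (hV : Continuous V) (hZ : Integrable (gibbsWeight α V))
    {F : Phase d → ℝ} :
    Integrable F (gibbs α V) ↔ Integrable (fun x => F x * gibbsDensity α V x) := by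
  have hm : Measurable (gibbsDensity α V) :=
    (contDiff_gibbsDensity (n := 0) (contDiff_zero.2 hV)).continuous.measurable
  unfold gibbs lawOf
  rw [integrable_withDensity_iff hm.ennreal_ofReal (by simp)]
  simp only [ENNReal.toReal_ofReal (gibbsDensity_pos hZ _).le]

theorem integral_gibbs (hV : Continuous V) (hZ : Integrable (gibbsWeight α V))
    (F : Phase d → ℝ) : ∫ x, F x ∂(gibbs α V) = ∫ x, F x * gibbsDensity α V x := by
  have hm : Measurable (gibbsDensity α V) :=
    (contDiff_gibbsDensity (n := 0) (contDiff_zero.2 hV)).continuous.measurable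
  unfold gibbs lawOf
  rw [integral_withDensity_eq_integral_toReal_smul hm.ennreal_ofReal (by simp)]
  simp only [ENNReal.toReal_ofReal (gibbsDensity_pos hZ _).le, smul_eq_mul, mul_comm]

theorem isFiniteMeasure_gibbs (hZ : Integrable (gibbsWeight α V)) :
    IsFiniteMeasure (gibbs α V) :=
  isFiniteMeasure_withDensity_ofReal (hZ.const_mul _).2

/-- Integration by parts against the constant function 1. Integrability of G and G' replaces any
decay assumption at infinity. -/
theorem integral_eq_zero_of_hasPDerivAt {G G' : Phase d → ℝ} (k : Fin d ⊕ Fin d)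
    (hd : ∀ x, HasPDerivAt k G (G' x) x) (hG : Integrable G) (hG' : Integrable G') :
    ∫ x, G' x = 0 := by
  have h := integral_bilinear_hasLineDerivAt_right_eq_neg_left_of_integrable
    (μ := (volume : Measure (Phase d))) (f := fun _ : Phase d => (1 : ℝ)) (f' := fun _ => 0) (g := G)
    (g' := G') (v := EuclideanSpace.single k 1) (B := ContinuousLinearMap.mul ℝ ℝ)
    (by simp) (by simpa using hG') (by simpa using hG)
    (fun x _ => HasPDerivAt.const k 1 x) (fun x _ => hd x)
  simpa using h

/-- Integration by parts against the Gibbs measure. -/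
theorem integral_gibbs_pderiv_sub (hV : Differentiable ℝ V) (hZ : Integrable (gibbsWeight α V))
    {F F' : Phase d → ℝ} (k : Fin d ⊕ Fin d) (hd : ∀ x, HasPDerivAt k F (F' x) x)
    (hF : Integrable F (gibbs α V)) (hF' : Integrable F' (gibbs α V))
    (hUF : Integrable (fun x => gradH V k x * F x) (gibbs α V)) :
    ∫ x, (F' x - α * gradH V k x * F x) ∂(gibbs α V) = 0 := by
  have hi : Integrable (fun x => F' x - α * gradH V k x * F x) (gibbs α V) := by
    refine hF'.sub ((hUF.const_mul α).congr (Eventually.of_forall fun x => ?_))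
    simp only; ring
  rw [integral_gibbs hV.continuous hZ]
  refine integral_eq_zero_of_hasPDerivAt (G := fun x => F x * gibbsDensity α V x) k (fun x => ?_)
    ((integrable_gibbs_iff hV.continuous hZ).1 hF) ((integrable_gibbs_iff hV.continuous hZ).1 hi)
  exact ((hd x).mul (hasPDerivAt_gibbsDensity hV k x)).congr_deriv (by ring)

/-- Halving the momentum, as a linear map of phase space. -/
noncomputable def halveMom (d : ℕ) : Phase d →ₗ[ℝ] Phase d where
  toFun x := WithLp.toLp 2 fun k => Sum.elim (fun i => x (Sum.inl i)) (fun i => x (Sum.inr i) / 2) k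
  map_add' x y := by
    ext k; rcases k with k | k <;> simp [add_div]
  map_smul' r x := by
    ext k; rcases k with k | k <;> simp [mul_div_assoc]

/-- A linear change of variables with nonzero determinant. The result is a Gaussian in p of larger
variance, which serves as a dominating function in `memLp_mom`. -/
theorem integrable_gibbsWeight_halveMom (hZ : Integrable (gibbsWeight α V)) :
    Integrable (fun x => gibbsWeight α V (halveMom d x)) := by
  have hinj : Function.Injective (halveMom d) := by
    rw [injective_iff_map_eq_zero]
    intro x hx
    ext k
    have := congrArg (fun y : Phase d => y k) hx
    rcases k with k | k <;> simpa [halveMom] using this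
  let e := LinearEquiv.ofInjectiveEndo (halveMom d) hinj
  have hdet : LinearMap.det (halveMom d) ≠ 0 := by
    have := e.isUnit_det'
    exact this.ne_zero
  have hmeas : MeasurableEmbedding (halveMom d) :=
    e.toContinuousLinearEquiv.toHomeomorph.measurableEmbedding
  have h1 : Integrable (gibbsWeight α V) (Measure.map (halveMom d) volume) := by
    rw [Measure.map_linearMap_addHaar_eq_smul_addHaar volume hdet]
    exact hZ.smul_measure (by simp)
  exact hmeas.integrable_map_iff.1 h1

/-- Second moments of p follow from finiteness of the partition function alone: part of the Gaussian
absorbs p_j², and the rest is the weight at (q, p/2). -/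
theorem memLp_mom (hα : 0 < α) (hV : Continuous V) (hZ : Integrable (gibbsWeight α V)) (j : Fin d) :
    MemLp (fun x => mom x j) 2 (gibbs α V) := by
  have hc : Continuous (fun x : Phase d => mom x j) := (contDiff_mom_apply (n := 0) j).continuous
  rw [memLp_two_iff_integrable_sq hc.aestronglyMeasurable, integrable_gibbs_iff hV hZ]
  have hm : Continuous (gibbsDensity α V) :=
    (contDiff_gibbsDensity (n := 0) (contDiff_zero.2 hV)).continuous
  refine ((integrable_gibbsWeight_halveMom hZ).const_mul
    ((∫ y, gibbsWeight α V y)⁻¹ * (8 / (3 * α)))).mono'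
      ((hc.pow 2).mul hm).aestronglyMeasurable (Eventually.of_forall fun x => ?_)
  have hZp := partition_pos hZ
  have hd := gibbsDensity_pos hZ x
  rw [Real.norm_of_nonneg (by positivity)]
  have hpos : pos (halveMom d x) = pos x := by
    ext i; simp [pos, halveMom]
  have hmom : mom (halveMom d x) = (1 / 2 : ℝ) • mom x := by
    ext i; simp [mom, halveMom]; ring
  have hle : mom x j ^ 2 ≤ ‖mom x‖ ^ 2 := by
    rw [EuclideanSpace.real_norm_sq_eq]
    exact Finset.single_le_sum (f := fun i => mom x i ^ 2) (fun i _ => by positivity)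
      (Finset.mem_univ j)
  -- Halving p leaves the exponent (α/8)|p|², so the factor split off has exponent α/2 - α/8 = 3α/8.
  have hexp : gibbsWeight α V x
      = gibbsWeight α V (halveMom d x) * Real.exp (-(3 * α / 8 * ‖mom x‖ ^ 2)) := by
    simp only [gibbsWeight, hpos, hmom, norm_smul, ← Real.exp_add]
    congr 1
    norm_num
    ring
  have h5 : mom x j ^ 2 * Real.exp (-(3 * α / 8 * ‖mom x‖ ^ 2)) ≤ 8 / (3 * α) := by
    set r := 3 * α / 8 * ‖mom x‖ ^ 2 with hr
    -- This is r ≤ exp r; with r = (3α/8)|p|² it yields the constant 8/(3α).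
    have h6 : r * Real.exp (-r) ≤ 1 := by
      rw [Real.exp_neg, ← div_eq_mul_inv, div_le_one (Real.exp_pos _)]
      linarith [Real.add_one_le_exp r]
    have h7 : ‖mom x‖ ^ 2 = 8 / (3 * α) * r := by rw [hr]; field_simp
    calc mom x j ^ 2 * Real.exp (-r) ≤ ‖mom x‖ ^ 2 * Real.exp (-r) := by gcongr
      _ = 8 / (3 * α) * (r * Real.exp (-r)) := by rw [h7]; ring
      _ ≤ 8 / (3 * α) * 1 := by gcongr
      _ = _ := mul_one _
  calc mom x j ^ 2 * gibbsDensity α V x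
      = (∫ y, gibbsWeight α V y)⁻¹ * (mom x j ^ 2 * Real.exp (-(3 * α / 8 * ‖mom x‖ ^ 2)))
        * gibbsWeight α V (halveMom d x) := by rw [gibbsDensity, hexp]; ring
    _ ≤ (∫ y, gibbsWeight α V y)⁻¹ * (8 / (3 * α)) * gibbsWeight α V (halveMom d x) := by
      have := (gibbsWeight_pos (α := α) (V := V) (halveMom d x)).le
      gcongr

/-- The Radon-Nikodym derivative of a law with respect to the Gibbs measure is the relative
density. -/
theorem rnDeriv_lawOf (hV : Continuous V) (hZ : Integrable (gibbsWeight α V)) {ρ : Phase d → ℝ}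
    (hρ : ∀ x, 0 ≤ ρ x) (hc : Continuous (relDensity α V ρ)) :
    ∀ᵐ x ∂(gibbs α V), ((lawOf ρ).rnDeriv (gibbs α V) x).toReal = relDensity α V ρ x := by
  have := isFiniteMeasure_gibbs hZ
  have hm : Measurable (gibbsDensity α V) :=
    (contDiff_gibbsDensity (n := 0) (contDiff_zero.2 hV)).continuous.measurable
  have hlaw : lawOf ρ = (gibbs α V).withDensity (fun x => ENNReal.ofReal (relDensity α V ρ x)) := by
    unfold gibbs lawOf
    rw [← withDensity_mul _ hm.ennreal_ofReal hc.measurable.ennreal_ofReal]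
    congr 1
    ext x
    have hd := gibbsDensity_pos hZ x
    rw [Pi.mul_apply, ← ENNReal.ofReal_mul hd.le, relDensity, mul_div_cancel₀ _ hd.ne']
  rw [hlaw]
  filter_upwards [Measure.rnDeriv_withDensity (gibbs α V) hc.measurable.ennreal_ofReal] with x hx
  rw [hx]
  exact ENNReal.toReal_ofReal (div_nonneg (hρ x) (gibbsDensity_pos hZ x).le)

end Gibbs

/-! ### Counting powers: bounds by u^m v^n g^r and the integrability they give. -/

section Growth

/-- A family of continuous functions bounded, uniformly for `s ∈ J`, by a multiple of
`u ^ m * v ^ n * g ^ r`. -/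
structure GrowthBound {X : Type} [TopologicalSpace X] (u v g : X → ℝ) (J : Set ℝ) (m n r : ℕ)
    (F : ℝ → X → ℝ) : Prop where
  cont : ∀ s ∈ J, Continuous (F s)
  bound : ∃ C, 0 ≤ C ∧ ∀ s ∈ J, ∀ x, |F s x| ≤ C * (u x ^ m * v x ^ n * g x ^ r)

namespace GrowthBound

variable {X : Type} [TopologicalSpace X] {u v g : X → ℝ} {J : Set ℝ} {m n r m' n' r' : ℕ}
  {F G : ℝ → X → ℝ}

theorem add (hF : GrowthBound u v g J m n r F) (hG : GrowthBound u v g J m n r G) :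
    GrowthBound u v g J m n r (fun s x => F s x + G s x) := by
  obtain ⟨C, hC, hF2⟩ := hF.bound
  obtain ⟨D, hD, hG2⟩ := hG.bound
  refine ⟨fun s hs => (hF.cont s hs).add (hG.cont s hs), C + D, by positivity, fun s hs x => ?_⟩
  have := abs_add_le (F s x) (G s x)
  linarith [hF2 s hs x, hG2 s hs x, add_mul C D (u x ^ m * v x ^ n * g x ^ r)]

theorem mul (hF : GrowthBound u v g J m n r F) (hG : GrowthBound u v g J m' n' r' G) :
    GrowthBound u v g J (m + m') (n + n') (r + r') (fun s x => F s x * G s x) := by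
  obtain ⟨C, hC, hF2⟩ := hF.bound
  obtain ⟨D, hD, hG2⟩ := hG.bound
  refine ⟨fun s hs => (hF.cont s hs).mul (hG.cont s hs), C * D, by positivity, fun s hs x => ?_⟩
  rw [abs_mul]
  calc |F s x| * |G s x| ≤ (C * (u x ^ m * v x ^ n * g x ^ r)) *
        (D * (u x ^ m' * v x ^ n' * g x ^ r')) :=
      mul_le_mul (hF2 s hs x) (hG2 s hs x) (abs_nonneg _) ((abs_nonneg _).trans (hF2 s hs x))
    _ = _ := by ring

theorem const_mul (c : ℝ) (hF : GrowthBound u v g J m n r F) :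
    GrowthBound u v g J m n r (fun s x => c * F s x) := by
  obtain ⟨C, hC, hF2⟩ := hF.bound
  refine ⟨fun s hs => continuous_const.mul (hF.cont s hs), |c| * C, by positivity,
    fun s hs x => ?_⟩
  rw [abs_mul, mul_assoc]
  exact mul_le_mul_of_nonneg_left (hF2 s hs x) (abs_nonneg _)

theorem neg (hF : GrowthBound u v g J m n r F) :
    GrowthBound u v g J m n r (fun s x => -F s x) := by
  simpa using hF.const_mul (-1)

theorem sub (hF : GrowthBound u v g J m n r F) (hG : GrowthBound u v g J m n r G) :
    GrowthBound u v g J m n r (fun s x => F s x - G s x) := by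
  simpa only [sub_eq_add_neg] using hF.add hG.neg

theorem zero : GrowthBound u v g J m n r (fun _ _ => 0) :=
  ⟨fun _ _ => continuous_const, 0, le_rfl, fun _ _ _ => by simp⟩

theorem sum {κ : Type*} {S : Finset κ} {F : κ → ℝ → X → ℝ}
    (hF : ∀ k ∈ S, GrowthBound u v g J m n r (F k)) :
    GrowthBound u v g J m n r (fun s x => ∑ k ∈ S, F k s x) := by
  classical
  induction S using Finset.induction_on with
  | empty => simpa using zero
  | insert k S hk ih =>
    simp only [Finset.sum_insert hk]
    exact (hF k (Finset.mem_insert_self k S)).add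
      (ih fun j hj => hF j (Finset.mem_insert_of_mem hj))

/-- Only the powers of u and v may be raised, since these are at least 1; g is merely nonnegative,
so its degree r stays fixed. -/
theorem mono (hu : ∀ x, 1 ≤ u x) (hv : ∀ x, 1 ≤ v x) (hg : ∀ x, 0 ≤ g x)
    (hF : GrowthBound u v g J m n r F) (hm : m ≤ m') (hn : n ≤ n') :
    GrowthBound u v g J m' n' r F := by
  obtain ⟨C, hC, hF2⟩ := hF.bound
  refine ⟨hF.cont, C, hC, fun s hs x => (hF2 s hs x).trans ?_⟩
  have h1 := hu x
  have h2 := hv x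
  have h3 := hg x
  gcongr

theorem const (c : ℝ) : GrowthBound u v g J 0 0 0 (fun _ _ => c) :=
  ⟨fun _ _ => continuous_const, |c|, abs_nonneg c, fun _ _ _ => by simp⟩

variable [MeasurableSpace X] [BorelSpace X] {μ : Measure X}

/-- A single integrable bound, for all times in `J`. -/
theorem exists_integrable_bound (hu : ∀ x, 1 ≤ u x) (hv : ∀ x, 1 ≤ v x) (hg : ∀ x, 0 ≤ g x)
    (hw : MemLp (fun x => u x * v x ^ 2 * g x) 2 μ) (hF : GrowthBound u v g J m n 2 F)
    (hm : m ≤ 2) (hn : n ≤ 4) :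
    ∃ B : X → ℝ, Integrable B μ ∧ ∀ s ∈ J, ∀ x, ‖F s x‖ ≤ B x := by
  -- The powers are raised to exactly u² v⁴ g² = (u v² g)², which is why the limits are 2 and 4.
  obtain ⟨C, hC, hF2⟩ := (hF.mono hu hv hg hm hn).bound
  refine ⟨fun x => C * (u x * v x ^ 2 * g x) ^ 2, hw.integrable_sq.const_mul C,
    fun s hs x => (hF2 s hs x).trans (le_of_eq ?_)⟩
  ring

/-- An expression of degree one in g can only be compared with u v² g itself, so the admissible
powers are halved. -/
theorem exists_memLp_bound (hu : ∀ x, 1 ≤ u x) (hv : ∀ x, 1 ≤ v x) (hg : ∀ x, 0 ≤ g x)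
    (hw : MemLp (fun x => u x * v x ^ 2 * g x) 2 μ) (hF : GrowthBound u v g J m n 1 F)
    (hm : m ≤ 1) (hn : n ≤ 2) :
    ∃ B : X → ℝ, MemLp B 2 μ ∧ ∀ s ∈ J, ∀ x, ‖F s x‖ ≤ B x := by
  obtain ⟨C, hC, hF2⟩ := (hF.mono hu hv hg hm hn).bound
  refine ⟨fun x => C * (u x * v x ^ 2 * g x), hw.const_mul C,
    fun s hs x => (hF2 s hs x).trans (le_of_eq ?_)⟩
  ring

theorem integrable [SecondCountableTopology X] (hu : ∀ x, 1 ≤ u x) (hv : ∀ x, 1 ≤ v x)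
    (hg : ∀ x, 0 ≤ g x)
    (hw : MemLp (fun x => u x * v x ^ 2 * g x) 2 μ) (hF : GrowthBound u v g J m n 2 F)
    (hm : m ≤ 2) (hn : n ≤ 4) {s : ℝ} (hs : s ∈ J) : Integrable (F s) μ := by
  obtain ⟨B, hB, hb⟩ := hF.exists_integrable_bound hu hv hg hw hm hn
  exact hB.mono' (hF.cont s hs).aestronglyMeasurable (Eventually.of_forall (hb s hs))

theorem memLp [SecondCountableTopology X] (hu : ∀ x, 1 ≤ u x) (hv : ∀ x, 1 ≤ v x)
    (hg : ∀ x, 0 ≤ g x)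
    (hw : MemLp (fun x => u x * v x ^ 2 * g x) 2 μ) (hF : GrowthBound u v g J m n 1 F)
    (hm : m ≤ 1) (hn : n ≤ 2) {s : ℝ} (hs : s ∈ J) : MemLp (F s) 2 μ := by
  obtain ⟨B, hB, hb⟩ := hF.exists_memLp_bound hu hv hg hw hm hn
  exact hB.mono' (hF.cont s hs).aestronglyMeasurable (Eventually.of_forall (hb s hs))

end GrowthBound

end Growth

/-! ### Iterated partial derivatives as values of the iterated Fréchet derivative. -/

section MultiIndex

variable {ι : Type} [Fintype ι] [DecidableEq ι]

/-- The partial derivative of order `n` in the coordinates listed by `w`. -/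
noncomputable def mpderiv {n : ℕ} (w : Fin n → ι) (f : EuclideanSpace ℝ ι → ℝ)
    (x : EuclideanSpace ℝ ι) : ℝ :=
  iteratedFDeriv ℝ n f x (fun a => EuclideanSpace.single (w a) 1)

/-- The coordinate vectors have norm 1, so the operator norm bound holds without a constant. This
transfers the domination by g to every partial derivative. -/
theorem abs_mpderiv_le {n : ℕ} (w : Fin n → ι) (f : EuclideanSpace ℝ ι → ℝ)
    (x : EuclideanSpace ℝ ι) : |mpderiv w f x| ≤ ‖iteratedFDeriv ℝ n f x‖ := by
  simpa [mpderiv] using (iteratedFDeriv ℝ n f x).le_opNorm (fun a => EuclideanSpace.single (w a) 1)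

theorem pderiv_mpderiv {n : ℕ} (w : Fin n → ι) {f : EuclideanSpace ℝ ι → ℝ}
    (hf : ContDiff ℝ (n + 1 : ℕ) f) (i : ι) :
    pderiv i (mpderiv w f) = mpderiv (Fin.cons i w : Fin (n + 1) → ι) f := by
  ext x
  have := pderiv_iteratedFDeriv hf.contDiffAt (x := x) i (fun a => EuclideanSpace.single (w a) 1)
  unfold mpderiv
  rw [this]
  congr 1
  ext a : 1
  refine Fin.cases ?_ (fun b => ?_) a <;> simp

theorem pderiv_eq_mpderiv {f : EuclideanSpace ℝ ι → ℝ} (hf : ContDiff ℝ 1 f) (i : ι) :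
    pderiv i f = mpderiv ![i] f := by
  have h0 : mpderiv (Fin.elim0 : Fin 0 → ι) f = f := by ext x; simp [mpderiv]
  have := pderiv_mpderiv (Fin.elim0 : Fin 0 → ι) (f := f) (by simpa using hf) i
  rw [h0] at this
  rw [this]
  congr 1

theorem pderiv_pderiv_eq_mpderiv {f : EuclideanSpace ℝ ι → ℝ} (hf : ContDiff ℝ 2 f) (i j : ι) :
    pderiv i (pderiv j f) = mpderiv ![i, j] f := by
  rw [pderiv_eq_mpderiv (hf.of_le (by norm_num)) j, pderiv_mpderiv _ (by exact_mod_cast hf)]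
  rfl

theorem pderiv_pderiv_pderiv_eq_mpderiv {f : EuclideanSpace ℝ ι → ℝ} (hf : ContDiff ℝ 3 f)
    (i j k : ι) : pderiv i (pderiv j (pderiv k f)) = mpderiv ![i, j, k] f := by
  rw [pderiv_pderiv_eq_mpderiv (hf.of_le (by norm_num)) j k,
    pderiv_mpderiv _ (by exact_mod_cast hf)]
  rfl

end MultiIndex

section Coefficients

variable {d : ℕ} {V : Pos d → ℝ} {Γ : Pos d → Matrix (Fin d) (Fin d) ℝ}

/-- Cramer's rule: the determinant and the adjugate are polynomials in the entries, and the
determinant does not vanish. -/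
theorem contDiff_inv_apply (hΓ : ∀ i j, ContDiff ℝ 1 (fun q => Γ q i j))
    (hinv : ∀ q, IsUnit (Γ q).det) (i j : Fin d) : ContDiff ℝ 1 (fun q => (Γ q)⁻¹ i j) := by
  have hdet : ∀ M : Pos d → Matrix (Fin d) (Fin d) ℝ, (∀ i j, ContDiff ℝ 1 (fun q => M q i j)) →
      ContDiff ℝ 1 (fun q => (M q).det) := by
    intro M hM
    simp only [Matrix.det_apply]
    refine ContDiff.sum fun σ _ => ContDiff.const_smul _ ?_
    exact contDiff_prod fun k _ => hM _ _
  have hadj : ContDiff ℝ 1 (fun q => (Γ q).adjugate i j) := by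
    simp only [Matrix.adjugate_apply]
    refine hdet _ fun k l => ?_
    by_cases hk : k = j
    · subst hk
      simp only [Matrix.updateRow_self]
      exact contDiff_const
    · simp only [Matrix.updateRow_ne hk]
      exact hΓ k l
  have : (fun q => (Γ q)⁻¹ i j) = fun q => ((Γ q).det)⁻¹ * (Γ q).adjugate i j := by
    ext q
    simp [Matrix.inv_def]
  rw [this]
  exact ((hdet Γ hΓ).inv fun q => (hinv q).ne_zero).mul hadj

/-- Differentiate Γ Γ⁻¹ = 1 entrywise and multiply by Γ⁻¹ on the left. The formula exhibits the
three factors that give the bound v³. -/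
theorem pderiv_inv_apply (hΓ : ∀ i j, ContDiff ℝ 1 (fun q => Γ q i j))
    (hinv : ∀ q, IsUnit (Γ q).det) (i j k : Fin d) (q : Pos d) :
    pderiv k (fun q => (Γ q)⁻¹ i j) q
      = -∑ l, ∑ m, (Γ q)⁻¹ i l * pderiv k (fun q => Γ q l m) q * (Γ q)⁻¹ m j := by
  have hG := contDiff_inv_apply hΓ hinv
  set D : Matrix (Fin d) (Fin d) ℝ := Matrix.of fun l m => pderiv k (fun q => Γ q l m) q with hD
  set E : Matrix (Fin d) (Fin d) ℝ := Matrix.of fun l m => pderiv k (fun q => (Γ q)⁻¹ l m) q with hE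
  have hsum : D * (Γ q)⁻¹ + Γ q * E = 0 := by
    ext l m
    have h1 : HasPDerivAt k (fun q => ∑ n, Γ q l n * (Γ q)⁻¹ n m)
        (∑ n, (pderiv k (fun q => Γ q l n) q * (Γ q)⁻¹ n m
          + Γ q l n * pderiv k (fun q => (Γ q)⁻¹ n m) q)) q :=
      HasPDerivAt.sum fun n _ =>
        (HasPDerivAt.of_differentiable ((hΓ l n).differentiable (by norm_num) q) k).mul
          (HasPDerivAt.of_differentiable ((hG n m).differentiable (by norm_num) q) k)
    have h2 : (fun q => ∑ n, Γ q l n * (Γ q)⁻¹ n m) = fun _ => (1 : Matrix (Fin d) (Fin d) ℝ) l m := by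
      ext q'
      rw [← Matrix.mul_apply, Matrix.mul_nonsing_inv _ (hinv q')]
    rw [h2] at h1
    have h3 := HasLineDerivAt.unique h1 (HasPDerivAt.const k _ q)
    simpa [Matrix.mul_apply, Finset.sum_add_distrib, hD, hE] using h3
  have hE2 : E = -((Γ q)⁻¹ * D * (Γ q)⁻¹) := by
    have h4 : (Γ q)⁻¹ * (D * (Γ q)⁻¹ + Γ q * E) = 0 := by rw [hsum, mul_zero]
    rw [mul_add, ← mul_assoc, ← mul_assoc, Matrix.nonsing_inv_mul _ (hinv q), one_mul] at h4
    exact (neg_eq_of_add_eq_zero_right h4).symm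
  have h5 := congrFun (congrFun hE2 i) j
  rw [hE] at h5
  simp only [Matrix.of_apply, Matrix.neg_apply, Matrix.mul_apply, Finset.sum_mul] at h5
  rw [h5, Finset.sum_comm]
  simp [hD]

theorem contDiff_matS (a b c : ℝ) (hΓ : ∀ i j, ContDiff ℝ 1 (fun q => Γ q i j))
    (hinv : ∀ q, IsUnit (Γ q).det) (k l : Fin d ⊕ Fin d) :
    ContDiff ℝ 1 (fun q => matS a b c Γ q k l) := by
  have hG := contDiff_inv_apply hΓ hinv
  rcases k with k | k <;> rcases l with l | l
  · simp only [matS, Matrix.fromBlocks_apply₁₁, Matrix.smul_apply, smul_eq_mul, Matrix.mul_apply]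
    exact contDiff_const.mul (ContDiff.sum fun m _ => (hG k m).mul (hG m l))
  · simp only [matS, Matrix.fromBlocks_apply₁₂, Matrix.smul_apply, smul_eq_mul]
    exact contDiff_const.mul (hG k l)
  · simp only [matS, Matrix.fromBlocks_apply₂₁, Matrix.smul_apply, smul_eq_mul]
    exact contDiff_const.mul (hG k l)
  · simp only [matS, Matrix.fromBlocks_apply₂₂]
    exact contDiff_const

theorem pderiv_comp_pos_inl {f : Pos d → ℝ} (hf : Differentiable ℝ f) (i : Fin d) (x : Phase d) :
    pderiv (Sum.inl i) (fun y : Phase d => f (pos y)) x = pderiv i f (pos x) :=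
  (hasPDerivAt_comp_pos hf (Sum.inl i) x).pderiv_eq
    (hf.comp ((contDiff_pos (n := 1)).differentiable (by norm_num)) x)

theorem pderiv_comp_pos_inr {f : Pos d → ℝ} (hf : Differentiable ℝ f) (i : Fin d) (x : Phase d) :
    pderiv (Sum.inr i) (fun y : Phase d => f (pos y)) x = 0 :=
  (hasPDerivAt_comp_pos hf (Sum.inr i) x).pderiv_eq
    (hf.comp ((contDiff_pos (n := 1)).differentiable (by norm_num)) x)

/-- The factor of `coeffSize` that depends on the potential. -/
noncomputable def sizeV (V : Pos d → ℝ) (x : Phase d) : ℝ :=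
  1 + ‖mom x‖ + ∑ i, |pderiv i V (pos x)| + ∑ i, ∑ j, |hess V (pos x) i j|

/-- The base of the factor of `coeffSize` that depends on the friction. -/
noncomputable def sizeΓ (Γ : Pos d → Matrix (Fin d) (Fin d) ℝ) (x : Phase d) : ℝ :=
  1 + ∑ i, ∑ j, |Γ (pos x) i j| + ∑ i, ∑ j, |(Γ (pos x))⁻¹ i j|
      + ∑ i, ∑ j, ∑ k, |pderiv k (fun q => Γ q i j) (pos x)|

theorem sum_abs_nonneg {κ : Type*} (s : Finset κ) (f : κ → ℝ) : 0 ≤ ∑ i ∈ s, |f i| :=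
  Finset.sum_nonneg fun _ _ => abs_nonneg _

theorem abs_le_sum {κ : Type*} [Fintype κ] (f : κ → ℝ) (i : κ) : |f i| ≤ ∑ i, |f i| :=
  Finset.single_le_sum (f := fun i => |f i|) (fun _ _ => abs_nonneg _) (Finset.mem_univ i)

theorem abs_le_sum_sum {κ κ' : Type*} [Fintype κ] [Fintype κ'] (f : κ → κ' → ℝ) (i : κ) (j : κ') :
    |f i j| ≤ ∑ i, ∑ j, |f i j| :=
  (abs_le_sum (f i) j).trans (Finset.single_le_sum (f := fun i => ∑ j, |f i j|)
    (fun _ _ => sum_abs_nonneg _ _) (Finset.mem_univ i))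

theorem one_le_sizeV (x : Phase d) : 1 ≤ sizeV V x := by
  unfold sizeV
  have h1 := norm_nonneg (mom x)
  have h2 : 0 ≤ ∑ i, |pderiv i V (pos x)| := sum_abs_nonneg _ _
  have h3 : 0 ≤ ∑ i, ∑ j, |hess V (pos x) i j| :=
    Finset.sum_nonneg fun _ _ => sum_abs_nonneg _ _
  linarith

theorem one_le_sizeΓ (x : Phase d) : 1 ≤ sizeΓ Γ x := by
  unfold sizeΓ
  have h1 : 0 ≤ ∑ i, ∑ j, |Γ (pos x) i j| := Finset.sum_nonneg fun _ _ => sum_abs_nonneg _ _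
  have h2 : 0 ≤ ∑ i, ∑ j, |(Γ (pos x))⁻¹ i j| := Finset.sum_nonneg fun _ _ => sum_abs_nonneg _ _
  have h3 : 0 ≤ ∑ i, ∑ j, ∑ k, |pderiv k (fun q => Γ q i j) (pos x)| :=
    Finset.sum_nonneg fun _ _ => Finset.sum_nonneg fun _ _ => sum_abs_nonneg _ _
  linarith

variable {g : Phase d → ℝ} {J : Set ℝ}

theorem growth_of_le_sizeV {F : Phase d → ℝ} (hc : Continuous F) (hF : ∀ x, |F x| ≤ sizeV V x) :
    GrowthBound (sizeV V) (sizeΓ Γ) g J 1 0 0 (fun _ => F) :=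
  ⟨fun _ _ => hc, 1, zero_le_one, fun _ _ x => by simpa using hF x⟩

theorem growth_of_le_sizeΓ {F : Phase d → ℝ} (hc : Continuous F) (hF : ∀ x, |F x| ≤ sizeΓ Γ x) :
    GrowthBound (sizeV V) (sizeΓ Γ) g J 0 1 0 (fun _ => F) :=
  ⟨fun _ _ => hc, 1, zero_le_one, fun _ _ x => by simpa using hF x⟩

theorem growth_mom (j : Fin d) :
    GrowthBound (sizeV V) (sizeΓ Γ) g J 1 0 0 (fun _ x => mom x j) := by
  refine growth_of_le_sizeV (contDiff_mom_apply (n := 0) j).continuous fun x => ?_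
  have h1 := PiLp.norm_apply_le (mom x) j
  have h2 : 0 ≤ ∑ i, |pderiv i V (pos x)| := sum_abs_nonneg _ _
  have h3 : 0 ≤ ∑ i, ∑ j, |hess V (pos x) i j| :=
    Finset.sum_nonneg fun _ _ => sum_abs_nonneg _ _
  rw [Real.norm_eq_abs] at h1
  unfold sizeV
  linarith

theorem growth_gradV (hV : ContDiff ℝ 2 V) (j : Fin d) :
    GrowthBound (sizeV V) (sizeΓ Γ) g J 1 0 0 (fun _ x => pderiv j V (pos x)) := by
  refine growth_of_le_sizeV ((contDiff_pderiv (n := 1) (by exact_mod_cast hV) j).continuous.comp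
    (contDiff_pos (n := 0)).continuous) fun x => ?_
  have h1 := norm_nonneg (mom x)
  have h2 := abs_le_sum (fun i => pderiv i V (pos x)) j
  have h3 : 0 ≤ ∑ i, ∑ j, |hess V (pos x) i j| :=
    Finset.sum_nonneg fun _ _ => sum_abs_nonneg _ _
  unfold sizeV
  linarith

theorem growth_hess (hV : ContDiff ℝ 2 V) (i j : Fin d) :
    GrowthBound (sizeV V) (sizeΓ Γ) g J 1 0 0 (fun _ x => hess V (pos x) i j) := by
  have hc : Continuous (pderiv i (pderiv j V)) :=
    (contDiff_pderiv (n := 0) (contDiff_pderiv (n := 1) (by exact_mod_cast hV) j) i).continuous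
  refine growth_of_le_sizeV (hc.comp (contDiff_pos (n := 0)).continuous) fun x => ?_
  have h1 := norm_nonneg (mom x)
  have h2 : 0 ≤ ∑ i, |pderiv i V (pos x)| := sum_abs_nonneg _ _
  have h3 := abs_le_sum_sum (fun i j => hess V (pos x) i j) i j
  unfold sizeV
  linarith

theorem growth_Γ (hΓ : ∀ i j, ContDiff ℝ 1 (fun q => Γ q i j)) (i j : Fin d) :
    GrowthBound (sizeV V) (sizeΓ Γ) g J 0 1 0 (fun _ x => Γ (pos x) i j) := by
  refine growth_of_le_sizeΓ ((hΓ i j).continuous.comp (contDiff_pos (n := 0)).continuous)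
    fun x => ?_
  have h1 := abs_le_sum_sum (fun i j => Γ (pos x) i j) i j
  have h2 : 0 ≤ ∑ i, ∑ j, |(Γ (pos x))⁻¹ i j| := Finset.sum_nonneg fun _ _ => sum_abs_nonneg _ _
  have h3 : 0 ≤ ∑ i, ∑ j, ∑ k, |pderiv k (fun q => Γ q i j) (pos x)| :=
    Finset.sum_nonneg fun _ _ => Finset.sum_nonneg fun _ _ => sum_abs_nonneg _ _
  unfold sizeΓ
  linarith

theorem growth_inv (hΓ : ∀ i j, ContDiff ℝ 1 (fun q => Γ q i j))
    (hinv : ∀ q, IsUnit (Γ q).det) (i j : Fin d) :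
    GrowthBound (sizeV V) (sizeΓ Γ) g J 0 1 0 (fun _ x => (Γ (pos x))⁻¹ i j) := by
  refine growth_of_le_sizeΓ ((contDiff_inv_apply hΓ hinv i j).continuous.comp
    (contDiff_pos (n := 0)).continuous) fun x => ?_
  have h1 : 0 ≤ ∑ i, ∑ j, |Γ (pos x) i j| := Finset.sum_nonneg fun _ _ => sum_abs_nonneg _ _
  have h2 := abs_le_sum_sum (fun i j => (Γ (pos x))⁻¹ i j) i j
  have h3 : 0 ≤ ∑ i, ∑ j, ∑ k, |pderiv k (fun q => Γ q i j) (pos x)| :=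
    Finset.sum_nonneg fun _ _ => Finset.sum_nonneg fun _ _ => sum_abs_nonneg _ _
  unfold sizeΓ
  linarith

theorem growth_pderiv_Γ (hΓ : ∀ i j, ContDiff ℝ 1 (fun q => Γ q i j)) (i j k : Fin d) :
    GrowthBound (sizeV V) (sizeΓ Γ) g J 0 1 0
      (fun _ x => pderiv k (fun q => Γ q i j) (pos x)) := by
  have hc := (contDiff_pderiv (n := 0) (by exact_mod_cast (hΓ i j)) k).continuous
  refine growth_of_le_sizeΓ (hc.comp (contDiff_pos (n := 0)).continuous) fun x => ?_
  have h1 : 0 ≤ ∑ i, ∑ j, |Γ (pos x) i j| := Finset.sum_nonneg fun _ _ => sum_abs_nonneg _ _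
  have h2 : 0 ≤ ∑ i, ∑ j, |(Γ (pos x))⁻¹ i j| := Finset.sum_nonneg fun _ _ => sum_abs_nonneg _ _
  have h3 : |pderiv k (fun q => Γ q i j) (pos x)|
      ≤ ∑ i, ∑ j, ∑ k, |pderiv k (fun q => Γ q i j) (pos x)| :=
    (abs_le_sum_sum (fun j k => pderiv k (fun q => Γ q i j) (pos x)) j k).trans
      (Finset.single_le_sum (f := fun i => ∑ j, ∑ k, |pderiv k (fun q => Γ q i j) (pos x)|)
        (fun _ _ => Finset.sum_nonneg fun _ _ => sum_abs_nonneg _ _) (Finset.mem_univ i))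
  unfold sizeΓ
  linarith

theorem dGamma_inl (hΓ : ∀ i j, ContDiff ℝ 1 (fun q => Γ q i j)) (k i j : Fin d) (x : Phase d) :
    dGamma Γ (Sum.inl k) x i j = pderiv k (fun q => Γ q i j) (pos x) :=
  pderiv_comp_pos_inl ((hΓ i j).differentiable (by norm_num)) k x

theorem dGamma_inr (hΓ : ∀ i j, ContDiff ℝ 1 (fun q => Γ q i j)) (k i j : Fin d) (x : Phase d) :
    dGamma Γ (Sum.inr k) x i j = 0 :=
  pderiv_comp_pos_inr ((hΓ i j).differentiable (by norm_num)) k x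

theorem growth_dGamma (hΓ : ∀ i j, ContDiff ℝ 1 (fun q => Γ q i j)) (k : Fin d ⊕ Fin d)
    (i j : Fin d) :
    GrowthBound (sizeV V) (sizeΓ Γ) g J 0 1 0 (fun _ x => dGamma Γ k x i j) := by
  rcases k with k | k
  · simp only [dGamma_inl hΓ]
    exact growth_pderiv_Γ hΓ i j k
  · simp only [dGamma_inr hΓ]
    exact GrowthBound.zero

theorem growth_pderiv_inv (hΓ : ∀ i j, ContDiff ℝ 1 (fun q => Γ q i j))
    (hinv : ∀ q, IsUnit (Γ q).det) (i j k : Fin d) :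
    GrowthBound (sizeV V) (sizeΓ Γ) g J 0 3 0
      (fun _ x => pderiv k (fun q => (Γ q)⁻¹ i j) (pos x)) := by
  simp only [pderiv_inv_apply hΓ hinv]
  exact (GrowthBound.sum fun l _ => GrowthBound.sum fun m _ =>
    ((growth_inv hΓ hinv i l).mul (growth_pderiv_Γ hΓ l m k)).mul (growth_inv hΓ hinv m j)).neg

theorem growth_matS {a b c : ℝ} (hg : ∀ x, 0 ≤ g x) (hΓ : ∀ i j, ContDiff ℝ 1 (fun q => Γ q i j))
    (hinv : ∀ q, IsUnit (Γ q).det) (k l : Fin d ⊕ Fin d) :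
    GrowthBound (sizeV V) (sizeΓ Γ) g J 0 2 0 (fun _ x => matS a b c Γ (pos x) k l) := by
  rcases k with k | k <;> rcases l with l | l
  · simp only [matS, Matrix.fromBlocks_apply₁₁, Matrix.smul_apply, smul_eq_mul, Matrix.mul_apply]
    exact (GrowthBound.sum fun m _ =>
      (growth_inv hΓ hinv k m).mul (growth_inv hΓ hinv m l)).const_mul b
  · simp only [matS, Matrix.fromBlocks_apply₁₂, Matrix.smul_apply, smul_eq_mul]
    exact ((growth_inv hΓ hinv k l).const_mul a).mono one_le_sizeV one_le_sizeΓ hg (by norm_num)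
      (by norm_num)
  · simp only [matS, Matrix.fromBlocks_apply₂₁, Matrix.smul_apply, smul_eq_mul]
    exact ((growth_inv hΓ hinv k l).const_mul a).mono one_le_sizeV one_le_sizeΓ hg (by norm_num)
      (by norm_num)
  · simp only [matS, Matrix.fromBlocks_apply₂₂]
    exact (GrowthBound.const _).mono one_le_sizeV one_le_sizeΓ hg (by norm_num) (by norm_num)

/-- The derivative of an entry of `S` in a position coordinate. -/
noncomputable def dS (a b c : ℝ) (Γ : Pos d → Matrix (Fin d) (Fin d) ℝ) (j : Fin d)
    (k l : Fin d ⊕ Fin d) (q : Pos d) : ℝ :=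
  pderiv j (fun q => matS a b c Γ q k l) q

/-- The worst block is bΓ⁻²: its derivative has one factor ∂Γ and three factors Γ⁻¹, hence v⁴. This
exhausts the power of v that an expression quadratic in h may carry, and accounts for the square in
`coeffSize`. -/
theorem growth_dS {a b c : ℝ} (hg : ∀ x, 0 ≤ g x) (hΓ : ∀ i j, ContDiff ℝ 1 (fun q => Γ q i j))
    (hinv : ∀ q, IsUnit (Γ q).det) (j : Fin d) (k l : Fin d ⊕ Fin d) :
    GrowthBound (sizeV V) (sizeΓ Γ) g J 0 4 0 (fun _ x => dS a b c Γ j k l (pos x)) := by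
  have hG := contDiff_inv_apply hΓ hinv
  have hdiff : ∀ k l q, HasPDerivAt j (fun q => (Γ q)⁻¹ k l)
      (pderiv j (fun q => (Γ q)⁻¹ k l) q) q := fun k l q =>
    HasPDerivAt.of_differentiable ((hG k l).differentiable (by norm_num) q) j
  have hS := fun k l => (contDiff_matS a b c hΓ hinv k l).differentiable (by norm_num)
  have hgi : ∀ k l, GrowthBound (sizeV V) (sizeΓ Γ) g J 0 4 0
      (fun _ x => a * pderiv j (fun q => (Γ q)⁻¹ k l) (pos x)) := fun k l =>
    ((growth_pderiv_inv hΓ hinv k l j).const_mul a).mono one_le_sizeV one_le_sizeΓ hg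
      (by norm_num) (by norm_num)
  rcases k with k | k <;> rcases l with l | l
  · have : ∀ q, dS a b c Γ j (Sum.inl k) (Sum.inl l) q
        = b * ∑ m, (pderiv j (fun q => (Γ q)⁻¹ k m) q * (Γ q)⁻¹ m l
          + (Γ q)⁻¹ k m * pderiv j (fun q => (Γ q)⁻¹ m l) q) := by
      intro q
      refine HasPDerivAt.pderiv_eq ?_ (hS _ _ q)
      simp only [matS, Matrix.fromBlocks_apply₁₁, Matrix.smul_apply, smul_eq_mul, Matrix.mul_apply]
      exact (HasPDerivAt.sum fun m _ => (hdiff k m q).mul (hdiff m l q)).const_mul b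
    simp only [this]
    refine (GrowthBound.sum fun m _ => ?_).const_mul b
    exact ((growth_pderiv_inv hΓ hinv k m j).mul (growth_inv hΓ hinv m l)).add
      ((growth_inv hΓ hinv k m).mul (growth_pderiv_inv hΓ hinv m l j))
  · have : ∀ q, dS a b c Γ j (Sum.inl k) (Sum.inr l) q
        = a * pderiv j (fun q => (Γ q)⁻¹ k l) q := by
      intro q
      refine HasPDerivAt.pderiv_eq ?_ (hS _ _ q)
      simp only [matS, Matrix.fromBlocks_apply₁₂, Matrix.smul_apply, smul_eq_mul]
      exact (hdiff k l q).const_mul a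
    simp only [this]
    exact hgi k l
  · have : ∀ q, dS a b c Γ j (Sum.inr k) (Sum.inl l) q
        = a * pderiv j (fun q => (Γ q)⁻¹ k l) q := by
      intro q
      refine HasPDerivAt.pderiv_eq ?_ (hS _ _ q)
      simp only [matS, Matrix.fromBlocks_apply₂₁, Matrix.smul_apply, smul_eq_mul]
      exact (hdiff k l q).const_mul a
    simp only [this]
    exact hgi k l
  · have : ∀ q, dS a b c Γ j (Sum.inr k) (Sum.inr l) q = 0 := by
      intro q
      refine HasPDerivAt.pderiv_eq ?_ (hS _ _ q)
      simp only [matS, Matrix.fromBlocks_apply₂₂]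
      exact HasPDerivAt.const _ _ _
    simp only [this]
    exact GrowthBound.zero

end Coefficients

/-! ### The backward equation ∂_t h = L h and the commutators of L with partial derivatives. -/

section Generator

variable {d : ℕ} {α : ℝ} {V : Pos d → ℝ} {Γ : Pos d → Matrix (Fin d) (Fin d) ℝ}

/-- The Hamiltonian transport part of the backward equation. -/
noncomputable def transport (V : Pos d → ℝ) (f : Phase d → ℝ) (x : Phase d) : ℝ :=
  ∑ j, (-(mom x j) * pderiv (Sum.inl j) f x + pderiv j V (pos x) * pderiv (Sum.inr j) f x)

/-- The operator `∂/∂p_i - α p_i`, the negative of the adjoint of `∂/∂p_i` in `L²(π)`. -/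
noncomputable def divP (α : ℝ) (i : Fin d) (f : Phase d → ℝ) (x : Phase d) : ℝ :=
  pderiv (Sum.inr i) f x - α * mom x i * f x

/-- The operator `L` with `∂h/∂t = L h` for the relative density `h`. -/
noncomputable def gen (α : ℝ) (V : Pos d → ℝ) (Γ : Pos d → Matrix (Fin d) (Fin d) ℝ)
    (f : Phase d → ℝ) (x : Phase d) : ℝ :=
  transport V f x
    + α⁻¹ * ∑ i, ∑ j, Γ (pos x) i j * divP α i (pderiv (Sum.inr j) f) x

/-- The commutator terms of first order without derivatives of the friction. -/
noncomputable def commTerm (V : Pos d → ℝ) (Γ : Pos d → Matrix (Fin d) (Fin d) ℝ)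
    (k : Fin d ⊕ Fin d) (f : Phase d → ℝ) (x : Phase d) : ℝ :=
  Sum.elim (fun i => ∑ j, hess V (pos x) i j * pderiv (Sum.inr j) f x)
    (fun i => -pderiv (Sum.inl i) f x - ∑ j, Γ (pos x) i j * pderiv (Sum.inr j) f x) k

/-- The partial derivative of `gen` in the coordinate `k`. -/
noncomputable def dgen (α : ℝ) (V : Pos d → ℝ) (Γ : Pos d → Matrix (Fin d) (Fin d) ℝ)
    (k : Fin d ⊕ Fin d) (f : Phase d → ℝ) (x : Phase d) : ℝ :=
  gen α V Γ (pderiv k f) x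
    + α⁻¹ * ∑ i, ∑ j, dGamma Γ k x i j * divP α i (pderiv (Sum.inr j) f) x
    + commTerm V Γ k f x

/-- By the product rule, derivatives falling on h rebuild L ∂_k h. Those falling on ∇V give the
Hessian and those on p give `commTerm`; those on Γ give `dGamma`. -/
theorem hasPDerivAt_gen (hα : α ≠ 0) (hV : ContDiff ℝ 2 V)
    (hΓ : ∀ i j, ContDiff ℝ 1 (fun q => Γ q i j)) {f : Phase d → ℝ} (hf : ContDiff ℝ 3 f)
    (k : Fin d ⊕ Fin d) (x : Phase d) : HasPDerivAt k (gen α V Γ f) (dgen α V Γ k f x) x := by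
  have hf1 : ∀ j, ContDiff ℝ 2 (pderiv j f) := fun j =>
    contDiff_pderiv (n := 2) (by exact_mod_cast hf) j
  have hf2 : ∀ i j, ContDiff ℝ 1 (pderiv i (pderiv j f)) := fun i j =>
    contDiff_pderiv (n := 1) (by exact_mod_cast hf1 j) i
  have hf02 : ContDiff ℝ 2 f := hf.of_le (by norm_num)
  -- Symmetry of second derivatives puts ∂_k innermost, so that the result can be read as L applied
  -- to ∂_k f.
  have hd1 : ∀ j, HasPDerivAt k (pderiv j f) (pderiv j (pderiv k f) x) x := fun j => by
    rw [pderiv_comm hf02 j k]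
    exact HasPDerivAt.of_differentiable ((hf1 j).differentiable (by norm_num) x) k
  have hd2 : ∀ i j, HasPDerivAt k (pderiv i (pderiv j f)) (pderiv i (pderiv j (pderiv k f)) x) x :=
    fun i j => by
      have h1 : pderiv j (pderiv k f) = pderiv k (pderiv j f) := by
        ext y; exact pderiv_comm hf02 j k y
      rw [h1, pderiv_comm (hf1 j) i k]
      exact HasPDerivAt.of_differentiable ((hf2 i j).differentiable (by norm_num) x) k
  have hdV : ∀ j, HasPDerivAt k (fun y : Phase d => pderiv j V (pos y))
      (Sum.elim (fun i => hess V (pos x) i j) (fun _ => 0) k) x := fun j =>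
    hasPDerivAt_comp_pos ((contDiff_pderiv (n := 1) (by exact_mod_cast hV) j).differentiable
      (by norm_num)) k x
  have hdΓ : ∀ i j, HasPDerivAt k (fun y : Phase d => Γ (pos y) i j) (dGamma Γ k x i j) x :=
    fun i j => HasPDerivAt.of_differentiable
      (((hΓ i j).comp contDiff_pos).differentiable (by norm_num) x) k
  have hT : HasPDerivAt k (transport V f) _ x :=
    HasPDerivAt.sum fun j _ => ((hasPDerivAt_mom k j x).neg.mul (hd1 (Sum.inl j))).add
      ((hdV j).mul (hd1 (Sum.inr j)))
  have hD : HasPDerivAt k (fun y => ∑ i, ∑ j, Γ (pos y) i j * divP α i (pderiv (Sum.inr j) f) y)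
      _ x :=
    HasPDerivAt.sum fun i _ => HasPDerivAt.sum fun j _ => (hdΓ i j).mul
      ((hd2 (Sum.inr i) (Sum.inr j)).sub
        (((hasPDerivAt_mom k i x).const_mul α).mul (hd1 (Sum.inr j))))
  refine (hT.add (hD.const_mul α⁻¹)).congr_deriv ?_
  simp only [dgen, gen, transport, divP]
  rcases k with k | k
  · simp only [commTerm, Sum.elim_inl, reduceCtorEq, if_false, neg_zero, zero_mul, mul_zero,
      zero_add, Finset.sum_add_distrib, mul_add]
    ring
  · simp only [commTerm, Sum.elim_inr, Sum.inr.injEq, zero_mul, zero_add, dGamma_inr hΓ,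
      Finset.sum_const_zero, mul_zero, Finset.sum_add_distrib, neg_mul,
      Finset.sum_neg_distrib, ite_mul, one_mul, Finset.sum_ite_eq, Finset.mem_univ, if_true,
      mul_sub, Finset.sum_sub_distrib, mul_ite, mul_one]
    -- The derivative of the factor α p_i in D_i selects the row k of Γ; its α cancels the prefactor
    -- α⁻¹ and leaves the friction part of `commTerm`.
    have h1 : ∑ i, ∑ j, Γ (pos x) i j * (if k = i then α * pderiv (Sum.inr j) f x else 0)
        = α * ∑ j, Γ (pos x) k j * pderiv (Sum.inr j) f x := by
      rw [Finset.sum_eq_single k]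
      · rw [Finset.mul_sum]
        refine Finset.sum_congr rfl fun j _ => ?_
        simp only [if_true]; ring
      · intro i _ hi
        simp [Ne.symm hi]
      · simp
    simp only [mul_add (Γ (pos x) _ _), Finset.sum_add_distrib, h1]
    have h2 : α⁻¹ * (α * ∑ j, Γ (pos x) k j * pderiv (Sum.inr j) f x)
        = ∑ j, Γ (pos x) k j * pderiv (Sum.inr j) f x := inv_mul_cancel_left₀ hα _
    linear_combination -h2

/-- Substitute ρ = hπ in the flux. The zeroth-order terms α h p·∇V from the q-block and the p-block
cancel, which is the stationarity of π under the Hamiltonian flow. -/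
theorem hasDerivAt_relDensity (hα : α ≠ 0) (hV : ContDiff ℝ 2 V) (hZ : Integrable (gibbsWeight α V))
    (hΓ : ∀ i j, ContDiff ℝ 1 (fun q => Γ q i j)) {I : Set ℝ} {ρ : ℝ → Phase d → ℝ}
    (hFP : SolvesFokkerPlanck α V Γ I ρ) {t : ℝ} (ht : t ∈ I)
    (hh : ContDiff ℝ 3 (relDensity α V (ρ t))) (x : Phase d) :
    HasDerivAt (fun s => relDensity α V (ρ s) x) (gen α V Γ (relDensity α V (ρ t)) x) t := by
  set h := relDensity α V (ρ t) with hdef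
  set G := gibbsDensity α V with hG
  have hGd : ContDiff ℝ 2 G := contDiff_gibbsDensity hV
  have hGpos : ∀ y, G y ≠ 0 := fun y => (gibbsDensity_pos hZ y).ne'
  have hρ : ρ t = fun y => h y * G y := by
    ext y; rw [hdef, relDensity, div_mul_cancel₀ _ (hGpos y)]
  have hGp : ∀ k y, HasPDerivAt k G (-(α * gradH V k y) * G y) y := fun k y =>
    hasPDerivAt_gibbsDensity (hV.differentiable (by norm_num)) k y
  have hhp : ∀ k y, HasPDerivAt k h (pderiv k h y) y := fun k y =>
    HasPDerivAt.of_differentiable (hh.differentiable (by norm_num) y) k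
  have hf1 : ∀ j, ContDiff ℝ 2 (pderiv j h) := fun j =>
    contDiff_pderiv (n := 2) (by exact_mod_cast hh) j
  have hV1 : ∀ j, ContDiff ℝ 1 (fun y : Phase d => pderiv j V (pos y)) := fun j =>
    (contDiff_pderiv (n := 1) (by exact_mod_cast hV) j).comp contDiff_pos
  have hΓ1 : ∀ i j, ContDiff ℝ 1 (fun y : Phase d => Γ (pos y) i j) := fun i j =>
    (hΓ i j).comp contDiff_pos
  have hh1 : ContDiff ℝ 1 h := hh.of_le (by norm_num)
  have hG1 : ContDiff ℝ 1 G := hGd.of_le (by norm_num)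
  have hgp : ∀ j y, gradP (ρ t) y j = (pderiv (Sum.inr j) h y - α * mom y j * h y) * G y := by
    intro j y
    have hdiff : DifferentiableAt ℝ (ρ t) y := by
      rw [hρ]; exact (hh1.mul hG1).differentiable (by norm_num) y
    refine HasPDerivAt.pderiv_eq ?_ hdiff
    rw [hρ]
    refine ((hhp (Sum.inr j) y).mul (hGp (Sum.inr j) y)).congr_deriv ?_
    simp only [gradH, Sum.elim_inr]
    ring
  have hq : ∀ i, pderiv (Sum.inl i) (fun y => flux α V Γ (ρ t) y (Sum.inl i)) x
      = (mom x i * pderiv (Sum.inl i) h x - α * pderiv i V (pos x) * mom x i * h x) * G x := by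
    intro i
    have hfl : (fun y => flux α V Γ (ρ t) y (Sum.inl i)) = fun y => (h y * mom y i) * G y := by
      ext y
      simp only [flux, Sum.elim_inl, hρ]
      ring
    rw [hfl]
    have hdiff : DifferentiableAt ℝ (fun y => (h y * mom y i) * G y) x :=
      ((hh1.mul (contDiff_mom_apply i)).mul hG1).differentiable (by norm_num) x
    refine HasPDerivAt.pderiv_eq ?_ hdiff
    refine (((hhp (Sum.inl i) x).mul (hasPDerivAt_mom (Sum.inl i) i x)).mul
      (hGp (Sum.inl i) x)).congr_deriv ?_
    simp only [gradH, Sum.elim_inl, reduceCtorEq, if_false]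
    ring
  have hp : ∀ i, pderiv (Sum.inr i) (fun y => flux α V Γ (ρ t) y (Sum.inr i)) x
      = (-(pderiv i V (pos x) * pderiv (Sum.inr i) h x) + α * pderiv i V (pos x) * mom x i * h x
        - α⁻¹ * ∑ j, Γ (pos x) i j * divP α i (pderiv (Sum.inr j) h) x) * G x := by
    intro i
    -- The drift -Γp cancels against the part of -α⁻¹Γ∇_pρ in which the derivative falls on π:
    -- friction and noise balance at temperature α⁻¹.
    have hfl : (fun y => flux α V Γ (ρ t) y (Sum.inr i)) = fun y =>
        (-(h y * pderiv i V (pos y)) - α⁻¹ * ∑ j, Γ (pos y) i j * pderiv (Sum.inr j) h y) * G y := by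
      ext y
      simp only [flux, Sum.elim_inr, Matrix.mulVec, dotProduct, hgp]
      simp only [hρ]
      have : ∀ j, Γ (pos y) i j * ((pderiv (Sum.inr j) h y - α * mom y j * h y) * G y)
          = (Γ (pos y) i j * pderiv (Sum.inr j) h y) * G y
            - (Γ (pos y) i j * mom y j) * (α * h y * G y) := fun j => by ring
      simp only [this, Finset.sum_sub_distrib, ← Finset.sum_mul]
      field_simp
      ring
    rw [hfl]
    have hdiff : DifferentiableAt ℝ (fun y =>
        (-(h y * pderiv i V (pos y)) - α⁻¹ * ∑ j, Γ (pos y) i j * pderiv (Sum.inr j) h y) * G y)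
        x := by
      refine ContDiff.differentiable (n := 1) ?_ (by norm_num) x
      refine ContDiff.mul (((hh1.mul (hV1 i)).neg).sub (contDiff_const.mul
        (ContDiff.sum fun j _ => (hΓ1 i j).mul ((hf1 _).of_le (by norm_num))))) hG1
    refine HasPDerivAt.pderiv_eq ?_ hdiff
    have hsum : HasPDerivAt (Sum.inr i)
        (fun y => ∑ j, Γ (pos y) i j * pderiv (Sum.inr j) h y)
        (∑ j, Γ (pos x) i j * pderiv (Sum.inr i) (pderiv (Sum.inr j) h) x) x := by
      refine HasPDerivAt.sum fun j _ => ?_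
      refine ((hasPDerivAt_comp_pos_inr (fun q => Γ q i j) x i).mul
        (HasPDerivAt.of_differentiable ((hf1 (Sum.inr j)).differentiable (by norm_num) x)
          _)).congr_deriv (by ring)
    refine (((((hhp (Sum.inr i) x).mul (hasPDerivAt_comp_pos_inr (pderiv i V) x i)).neg).sub
      (hsum.const_mul α⁻¹)).mul (hGp (Sum.inr i) x)).congr_deriv ?_
    simp only [gradH, Sum.elim_inr, divP]
    have : ∀ j, Γ (pos x) i j * (pderiv (Sum.inr i) (pderiv (Sum.inr j) h) x
          - α * mom x i * pderiv (Sum.inr j) h x)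
        = Γ (pos x) i j * pderiv (Sum.inr i) (pderiv (Sum.inr j) h) x
          - (Γ (pos x) i j * pderiv (Sum.inr j) h x) * (α * mom x i) := fun j => by ring
    simp only [this, Finset.sum_sub_distrib, ← Finset.sum_mul]
    ring
  have h1 := (hFP t ht x).div_const (G x)
  refine h1.congr_deriv ?_
  rw [div_eq_iff (hGpos x), Fintype.sum_sum_type]
  simp only [hq, hp, ← Finset.sum_mul, gen, transport]
  rw [← add_mul, ← neg_mul]
  congr 1
  rw [Finset.mul_sum, ← Finset.sum_add_distrib, ← Finset.sum_add_distrib, ← Finset.sum_neg_distrib]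
  exact Finset.sum_congr rfl fun i _ => by ring

end Generator

/-! ### Functions with zero Gibbs integral, and Leibniz rules for T and D_i. -/

section NullFunctions

/-- An integrable function with vanishing integral. -/
def IsNullFun {X : Type} [MeasurableSpace X] (μ : Measure X) (F : X → ℝ) : Prop :=
  Integrable F μ ∧ ∫ x, F x ∂μ = 0

namespace IsNullFun

variable {X : Type} [MeasurableSpace X] {μ : Measure X} {F G : X → ℝ}

theorem add (hF : IsNullFun μ F) (hG : IsNullFun μ G) : IsNullFun μ (fun x => F x + G x) :=
  ⟨hF.1.add hG.1, by rw [integral_add hF.1 hG.1, hF.2, hG.2, add_zero]⟩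

theorem const_mul (r : ℝ) (hF : IsNullFun μ F) : IsNullFun μ (fun x => r * F x) :=
  ⟨hF.1.const_mul r, by rw [integral_const_mul, hF.2, mul_zero]⟩

theorem sum {κ : Type*} {s : Finset κ} {F : κ → X → ℝ} (hF : ∀ k ∈ s, IsNullFun μ (F k)) :
    IsNullFun μ (fun x => ∑ k ∈ s, F k x) :=
  ⟨integrable_finsetSum _ fun k hk => (hF k hk).1, by
    rw [integral_finsetSum _ fun k hk => (hF k hk).1]
    exact Finset.sum_eq_zero fun k hk => (hF k hk).2⟩

theorem congr (hF : IsNullFun μ F) (h : ∀ x, F x = G x) : IsNullFun μ G := by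
  have : F = G := funext h
  rwa [← this]

end IsNullFun

variable {d : ℕ} {α : ℝ} {V : Pos d → ℝ}

/-- Integration by parts in p_i alone, so φ need not be differentiable in q. Hence first derivatives
of Γ are allowed as coefficients although Γ is only C¹. -/
theorem isNullFun_divP (hV : Differentiable ℝ V) (hZ : Integrable (gibbsWeight α V)) (i : Fin d)
    {φ F : Phase d → ℝ} (hφ : ∀ x, HasPDerivAt (Sum.inr i) φ 0 x) (hF : Differentiable ℝ F)
    (h0 : Integrable (fun x => φ x * F x) (gibbs α V))
    (h1 : Integrable (fun x => φ x * pderiv (Sum.inr i) F x) (gibbs α V))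
    (h2 : Integrable (fun x => mom x i * (φ x * F x)) (gibbs α V)) :
    IsNullFun (gibbs α V) (fun x => φ x * divP α i F x) := by
  have hd : ∀ x, HasPDerivAt (Sum.inr i) (fun x => φ x * F x) (φ x * pderiv (Sum.inr i) F x) x :=
    fun x => ((hφ x).mul (HasPDerivAt.of_differentiable (hF x) _)).congr_deriv (by ring)
  have h3 := integral_gibbs_pderiv_sub hV hZ (Sum.inr i) hd h0 h1 h2
  have heq : (fun x => φ x * divP α i F x)
      = fun x => φ x * pderiv (Sum.inr i) F x - α * gradH V (Sum.inr i) x * (φ x * F x) := by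
    ext x
    simp only [divP, gradH, Sum.elim_inr]
    ring
  rw [heq]
  refine ⟨h1.sub ((h2.const_mul α).congr (Eventually.of_forall fun x => ?_)), h3⟩
  simp only [gradH, Sum.elim_inr]
  ring

/-- Integrate by parts -p_j ∂_{q_j} F in q_j and ∂_jV ∂_{p_j} F in p_j; the two contributions α p_j
∂_jV F have opposite signs. -/
theorem isNullFun_transport (hV : ContDiff ℝ 2 V) (hZ : Integrable (gibbsWeight α V))
    {F : Phase d → ℝ} (hF : Differentiable ℝ F)
    (hp : ∀ j, Integrable (fun x => mom x j * F x) (gibbs α V))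
    (hq : ∀ j, Integrable (fun x => pderiv j V (pos x) * F x) (gibbs α V))
    (hpF : ∀ j, Integrable (fun x => mom x j * pderiv (Sum.inl j) F x) (gibbs α V))
    (hqF : ∀ j, Integrable (fun x => pderiv j V (pos x) * pderiv (Sum.inr j) F x) (gibbs α V))
    (hpq : ∀ j, Integrable (fun x => mom x j * (pderiv j V (pos x) * F x)) (gibbs α V)) :
    IsNullFun (gibbs α V) (transport V F) := by
  have hV1 : Differentiable ℝ V := hV.differentiable (by norm_num)
  have h1 : ∀ j, IsNullFun (gibbs α V)
      (fun x => mom x j * pderiv (Sum.inl j) F x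
        - α * gradH V (Sum.inl j) x * (mom x j * F x)) := fun j => by
    have hU : Integrable (fun x => gradH V (Sum.inl j) x * (mom x j * F x)) (gibbs α V) :=
      (hpq j).congr (Eventually.of_forall fun x => by simp only [gradH, Sum.elim_inl]; ring)
    refine ⟨(hpF j).sub ((hU.const_mul α).congr (Eventually.of_forall fun x => by
      simp only; ring)), integral_gibbs_pderiv_sub hV1 hZ (Sum.inl j) (fun x => ?_) (hp j) (hpF j) hU⟩
    refine ((hasPDerivAt_mom (Sum.inl j) j x).mul
      (HasPDerivAt.of_differentiable (hF x) _)).congr_deriv ?_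
    simp
  have h2 : ∀ j, IsNullFun (gibbs α V)
      (fun x => pderiv j V (pos x) * divP α j F x) := fun j =>
    isNullFun_divP hV1 hZ j (fun x => hasPDerivAt_comp_pos_inr (pderiv j V) x j) hF (hq j) (hqF j)
      (hpq j)
  refine (IsNullFun.sum (s := Finset.univ) fun j _ => ((h1 j).const_mul (-1)).add (h2 j)).congr
    fun x => ?_
  simp only [transport, divP, gradH, Sum.elim_inl]
  exact Finset.sum_congr rfl fun j _ => by ring

theorem transport_mul {F G : Phase d → ℝ} (hF : Differentiable ℝ F) (hG : Differentiable ℝ G)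
    (x : Phase d) : transport V (fun y => F y * G y) x
      = transport V F x * G x + F x * transport V G x := by
  have h : ∀ k, pderiv k (fun y => F y * G y) x = pderiv k F x * G x + F x * pderiv k G x :=
    fun k => ((HasPDerivAt.of_differentiable (hF x) k).mul
      (HasPDerivAt.of_differentiable (hG x) k)).pderiv_eq ((hF x).mul (hG x))
  simp only [transport, h, Finset.sum_mul, Finset.mul_sum, ← Finset.sum_add_distrib]
  exact Finset.sum_congr rfl fun j _ => by ring

theorem transport_comp_pos {f : Pos d → ℝ} (hf : Differentiable ℝ f) (x : Phase d) :
    transport V (fun y : Phase d => f (pos y)) x = -∑ j, mom x j * pderiv j f (pos x) := by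
  simp only [transport, pderiv_comp_pos_inl hf, pderiv_comp_pos_inr hf]
  simp

theorem divP_mul {F G : Phase d → ℝ} (hF : Differentiable ℝ F) (hG : Differentiable ℝ G)
    (i : Fin d) (x : Phase d) : divP α i (fun y => F y * G y) x
      = pderiv (Sum.inr i) F x * G x + F x * divP α i G x := by
  have h : pderiv (Sum.inr i) (fun y => F y * G y) x
      = pderiv (Sum.inr i) F x * G x + F x * pderiv (Sum.inr i) G x :=
    ((HasPDerivAt.of_differentiable (hF x) _).mul
      (HasPDerivAt.of_differentiable (hG x) _)).pderiv_eq ((hF x).mul (hG x))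
  simp only [divP, h]
  ring

end NullFunctions

/-! ### The standing data, and growth bounds for h, its derivatives, L h and ∂_k L h. -/

section Regularity

variable {d : ℕ}

/-- Coefficients and a family of relative densities with a common bound for times in `J`. -/
structure RegularData (α : ℝ) (V : Pos d → ℝ) (Γ : Pos d → Matrix (Fin d) (Fin d) ℝ)
    (g : Phase d → ℝ) (J : Set ℝ) (h : ℝ → Phase d → ℝ) : Prop where
  α_pos : 0 < α
  contDiff_V : ContDiff ℝ 2 V
  integrable_weight : Integrable (gibbsWeight α V)
  contDiff_Γ : ∀ i j, ContDiff ℝ 1 (fun q => Γ q i j)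
  isUnit_det : ∀ q, IsUnit (Γ q).det
  nonneg : ∀ x, 0 ≤ g x
  memLp_bound : MemLp (fun x => sizeV V x * sizeΓ Γ x ^ 2 * g x) 2 (gibbs α V)
  contDiff : ∀ s ∈ J, ContDiff ℝ 3 (h s)
  bound : ∀ s ∈ J, ∀ k ≤ 3, ∀ x, ‖iteratedFDeriv ℝ k (h s) x‖ ≤ g x

namespace RegularData

variable {α a b c : ℝ} {V : Pos d → ℝ} {Γ : Pos d → Matrix (Fin d) (Fin d) ℝ}
  {g : Phase d → ℝ} {J : Set ℝ} {h : ℝ → Phase d → ℝ}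

theorem contDiff_pderiv (D : RegularData α V Γ g J h) {s : ℝ} (hs : s ∈ J) (k : Fin d ⊕ Fin d) :
    ContDiff ℝ 2 (pderiv k (h s)) :=
  KineticLangevin.contDiff_pderiv (n := 2) (by exact_mod_cast D.contDiff s hs) k

theorem contDiff_pderiv₂ (D : RegularData α V Γ g J h) {s : ℝ} (hs : s ∈ J)
    (k l : Fin d ⊕ Fin d) : ContDiff ℝ 1 (pderiv k (pderiv l (h s))) :=
  KineticLangevin.contDiff_pderiv (n := 1) (by exact_mod_cast D.contDiff_pderiv hs l) k

theorem differentiable (D : RegularData α V Γ g J h) {s : ℝ} (hs : s ∈ J) :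
    Differentiable ℝ (h s) := (D.contDiff s hs).differentiable (by norm_num)

theorem differentiable_pderiv (D : RegularData α V Γ g J h) {s : ℝ} (hs : s ∈ J)
    (k : Fin d ⊕ Fin d) : Differentiable ℝ (pderiv k (h s)) :=
  (D.contDiff_pderiv hs k).differentiable (by norm_num)

theorem differentiable_pderiv₂ (D : RegularData α V Γ g J h) {s : ℝ} (hs : s ∈ J)
    (k l : Fin d ⊕ Fin d) : Differentiable ℝ (pderiv k (pderiv l (h s))) :=
  (D.contDiff_pderiv₂ hs k l).differentiable (by norm_num)

theorem growth_of_le (hc : ∀ s ∈ J, Continuous (h s)) (hb : ∀ s ∈ J, ∀ x, |h s x| ≤ g x) :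
    GrowthBound (sizeV V) (sizeΓ Γ) g J 0 0 1 h :=
  ⟨hc, 1, zero_le_one, fun s hs x => by simpa using hb s hs x⟩

theorem growth (D : RegularData α V Γ g J h) : GrowthBound (sizeV V) (sizeΓ Γ) g J 0 0 1 h := by
  refine growth_of_le (fun s hs => (D.contDiff s hs).continuous) fun s hs x => ?_
  simpa using D.bound s hs 0 (by norm_num) x

theorem growth_pderiv (D : RegularData α V Γ g J h) (k : Fin d ⊕ Fin d) :
    GrowthBound (sizeV V) (sizeΓ Γ) g J 0 0 1 (fun s => pderiv k (h s)) := by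
  refine growth_of_le (fun s hs => (D.contDiff_pderiv hs k).continuous) fun s hs x => ?_
  rw [pderiv_eq_mpderiv ((D.contDiff s hs).of_le (by norm_num))]
  exact (abs_mpderiv_le _ _ _).trans (D.bound s hs 1 (by norm_num) x)

theorem growth_pderiv₂ (D : RegularData α V Γ g J h) (k l : Fin d ⊕ Fin d) :
    GrowthBound (sizeV V) (sizeΓ Γ) g J 0 0 1 (fun s => pderiv k (pderiv l (h s))) := by
  refine growth_of_le (fun s hs => (D.contDiff_pderiv₂ hs k l).continuous) fun s hs x => ?_
  rw [pderiv_pderiv_eq_mpderiv ((D.contDiff s hs).of_le (by norm_num))]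
  exact (abs_mpderiv_le _ _ _).trans (D.bound s hs 2 (by norm_num) x)

theorem growth_pderiv₃ (D : RegularData α V Γ g J h) (k l m : Fin d ⊕ Fin d) :
    GrowthBound (sizeV V) (sizeΓ Γ) g J 0 0 1 (fun s => pderiv k (pderiv l (pderiv m (h s)))) := by
  refine growth_of_le (fun s hs => (KineticLangevin.contDiff_pderiv (n := 0)
    (by exact_mod_cast D.contDiff_pderiv₂ hs l m) k).continuous) fun s hs x => ?_
  rw [pderiv_pderiv_pderiv_eq_mpderiv (D.contDiff s hs)]
  exact (abs_mpderiv_le _ _ _).trans (D.bound s hs 3 le_rfl x)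

theorem growth_matS (D : RegularData α V Γ g J h) (k l : Fin d ⊕ Fin d) :
    GrowthBound (sizeV V) (sizeΓ Γ) g J 0 2 0 (fun _ x => matS a b c Γ (pos x) k l) :=
  KineticLangevin.growth_matS D.nonneg D.contDiff_Γ D.isUnit_det k l

theorem growth_dS (D : RegularData α V Γ g J h) (j : Fin d) (k l : Fin d ⊕ Fin d) :
    GrowthBound (sizeV V) (sizeΓ Γ) g J 0 4 0 (fun _ x => dS a b c Γ j k l (pos x)) :=
  KineticLangevin.growth_dS D.nonneg D.contDiff_Γ D.isUnit_det j k l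

theorem growth_mono (D : RegularData α V Γ g J h) {m n m' n' r : ℕ} {F : ℝ → Phase d → ℝ}
    (hF : GrowthBound (sizeV V) (sizeΓ Γ) g J m n r F) (hm : m ≤ m') (hn : n ≤ n') :
    GrowthBound (sizeV V) (sizeΓ Γ) g J m' n' r F :=
  hF.mono one_le_sizeV one_le_sizeΓ D.nonneg hm hn

theorem integrable (D : RegularData α V Γ g J h) {m n : ℕ} {F : ℝ → Phase d → ℝ}
    (hF : GrowthBound (sizeV V) (sizeΓ Γ) g J m n 2 F) (hm : m ≤ 2) (hn : n ≤ 4) {s : ℝ}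
    (hs : s ∈ J) : Integrable (F s) (gibbs α V) :=
  hF.integrable one_le_sizeV one_le_sizeΓ D.nonneg D.memLp_bound hm hn hs

theorem memLp (D : RegularData α V Γ g J h) {m n : ℕ} {F : ℝ → Phase d → ℝ}
    (hF : GrowthBound (sizeV V) (sizeΓ Γ) g J m n 1 F) (hm : m ≤ 1) (hn : n ≤ 2) {s : ℝ}
    (hs : s ∈ J) : MemLp (F s) 2 (gibbs α V) :=
  hF.memLp one_le_sizeV one_le_sizeΓ D.nonneg D.memLp_bound hm hn hs

theorem integrable_of_linear (D : RegularData α V Γ g J h) {m n : ℕ} {F : ℝ → Phase d → ℝ}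
    (hF : GrowthBound (sizeV V) (sizeΓ Γ) g J m n 1 F) (hm : m ≤ 1) (hn : n ≤ 2) {s : ℝ}
    (hs : s ∈ J) : Integrable (F s) (gibbs α V) := by
  have := isFiniteMeasure_gibbs D.integrable_weight
  exact (D.memLp hF hm hn hs).integrable (by norm_num)

/-- Meant for terms linear in h with one more factor p_j than the weight allows: p_j is in L²(π) by
itself, so Cauchy–Schwarz applies. -/
theorem integrable_mom_mul (D : RegularData α V Γ g J h) {m n : ℕ} {F : ℝ → Phase d → ℝ}
    (hF : GrowthBound (sizeV V) (sizeΓ Γ) g J m n 1 F) (hm : m ≤ 1) (hn : n ≤ 2) {s : ℝ}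
    (hs : s ∈ J) (j : Fin d) : Integrable (fun x => mom x j * F s x) (gibbs α V) :=
  (memLp_mom D.α_pos D.contDiff_V.continuous D.integrable_weight j).integrable_mul
    (D.memLp hF hm hn hs)

theorem growth_transport (D : RegularData α V Γ g J h) {F : ℝ → Phase d → ℝ}
    (hF : ∀ k, GrowthBound (sizeV V) (sizeΓ Γ) g J 0 0 1 (fun s => pderiv k (F s))) :
    GrowthBound (sizeV V) (sizeΓ Γ) g J 1 0 1 (fun s => transport V (F s)) :=
  GrowthBound.sum fun j _ => ((growth_mom j).neg.mul (hF (Sum.inl j))).add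
    ((growth_gradV D.contDiff_V j).mul (hF (Sum.inr j)))

theorem growth_divP (D : RegularData α V Γ g J h) {F : ℝ → Phase d → ℝ} (i : Fin d) {r : ℕ}
    (hF : GrowthBound (sizeV V) (sizeΓ Γ) g J 0 0 r F)
    (hF' : GrowthBound (sizeV V) (sizeΓ Γ) g J 0 0 r (fun s => pderiv (Sum.inr i) (F s))) :
    GrowthBound (sizeV V) (sizeΓ Γ) g J 1 0 r (fun s => divP α i (F s)) := by
  have h1 := ((growth_mom (V := V) (Γ := Γ) (g := g) (J := J) i).const_mul α).mul hF
  simp only [zero_add, add_zero] at h1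
  exact (D.growth_mono hF' (by norm_num) le_rfl).sub h1

theorem growth_gen (D : RegularData α V Γ g J h) {F : ℝ → Phase d → ℝ}
    (hF : ∀ k, GrowthBound (sizeV V) (sizeΓ Γ) g J 0 0 1 (fun s => pderiv k (F s)))
    (hF' : ∀ k l, GrowthBound (sizeV V) (sizeΓ Γ) g J 0 0 1
      (fun s => pderiv k (pderiv l (F s)))) :
    GrowthBound (sizeV V) (sizeΓ Γ) g J 1 1 1 (fun s => gen α V Γ (F s)) :=
  (D.growth_mono (D.growth_transport hF) le_rfl (by norm_num)).add
    ((GrowthBound.sum fun i _ => GrowthBound.sum fun j _ => (growth_Γ D.contDiff_Γ i j).mul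
      (D.growth_divP i (hF (Sum.inr j)) (hF' _ _))).const_mul α⁻¹)

theorem growth_dgen (D : RegularData α V Γ g J h) (k : Fin d ⊕ Fin d) :
    GrowthBound (sizeV V) (sizeΓ Γ) g J 1 1 1 (fun s => dgen α V Γ k (h s)) := by
  refine ((D.growth_gen (fun l => D.growth_pderiv₂ l k) fun l m => D.growth_pderiv₃ l m k).add
    ((GrowthBound.sum fun i _ => GrowthBound.sum fun j _ => (growth_dGamma D.contDiff_Γ k i j).mul
      (D.growth_divP i (D.growth_pderiv (Sum.inr j)) (D.growth_pderiv₂ _ _))).const_mul α⁻¹)).add ?_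
  rcases k with k | k
  · have h1 : GrowthBound (sizeV V) (sizeΓ Γ) g J 1 0 1
        (fun s x => ∑ j, hess V (pos x) k j * pderiv (Sum.inr j) (h s) x) :=
      GrowthBound.sum fun j _ => (growth_hess D.contDiff_V k j).mul (D.growth_pderiv (Sum.inr j))
    exact D.growth_mono h1 le_rfl (by norm_num)
  · have h1 : GrowthBound (sizeV V) (sizeΓ Γ) g J 0 1 1
        (fun s x => ∑ j, Γ (pos x) k j * pderiv (Sum.inr j) (h s) x) :=
      GrowthBound.sum fun j _ => (growth_Γ D.contDiff_Γ k j).mul (D.growth_pderiv (Sum.inr j))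
    exact D.growth_mono ((D.growth_mono (D.growth_pderiv (Sum.inl k)).neg le_rfl
      (by norm_num)).sub h1) (by norm_num) le_rfl

end RegularData

end Regularity

/-! ### The null functions that enter the dissipation identity. -/

section NullTerms

variable {d : ℕ}

theorem hasPDerivAt_dGamma_inr {Γ : Pos d → Matrix (Fin d) (Fin d) ℝ}
    (hΓ : ∀ i j, ContDiff ℝ 1 (fun q => Γ q i j)) (k : Fin d ⊕ Fin d) (i j m : Fin d)
    (x : Phase d) : HasPDerivAt (Sum.inr m) (fun y => dGamma Γ k y i j) 0 x := by
  rcases k with k | k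
  · simp only [dGamma_inl hΓ]
    exact hasPDerivAt_comp_pos_inr (pderiv k fun q => Γ q i j) x m
  · simp only [dGamma_inr hΓ]
    exact HasPDerivAt.const _ _ _

namespace RegularData

variable {α a b c : ℝ} {V : Pos d → ℝ} {Γ : Pos d → Matrix (Fin d) (Fin d) ℝ}
  {g : Phase d → ℝ} {J : Set ℝ} {h : ℝ → Phase d → ℝ}

/-- Common form of the quadratic null terms built from D_i. The product F G costs g², the factor p_i
in D_i costs one u, and the coefficient may use up all of v⁴. -/
theorem isNullFun_mul_divP_mul (D : RegularData α V Γ g J h) {s : ℝ} (hs : s ∈ J) (i : Fin d)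
    {φ : Phase d → ℝ} {F G : ℝ → Phase d → ℝ} {n : ℕ} (hn : n ≤ 4)
    (hφ : GrowthBound (sizeV V) (sizeΓ Γ) g J 0 n 0 (fun _ => φ))
    (hφ' : ∀ x, HasPDerivAt (Sum.inr i) φ 0 x)
    (hF : Differentiable ℝ (F s)) (hG : Differentiable ℝ (G s))
    (hF0 : GrowthBound (sizeV V) (sizeΓ Γ) g J 0 0 1 F)
    (hG0 : GrowthBound (sizeV V) (sizeΓ Γ) g J 0 0 1 G)
    (hF1 : GrowthBound (sizeV V) (sizeΓ Γ) g J 0 0 1 (fun s => pderiv (Sum.inr i) (F s)))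
    (hG1 : GrowthBound (sizeV V) (sizeΓ Γ) g J 0 0 1 (fun s => pderiv (Sum.inr i) (G s))) :
    IsNullFun (gibbs α V) (fun x => φ x * divP α i (fun y => F s y * G s y) x) := by
  have hpd : ∀ x, pderiv (Sum.inr i) (fun y => F s y * G s y) x
      = pderiv (Sum.inr i) (F s) x * G s x + F s x * pderiv (Sum.inr i) (G s) x := fun x =>
    ((HasPDerivAt.of_differentiable (hF x) _).mul
      (HasPDerivAt.of_differentiable (hG x) _)).pderiv_eq ((hF x).mul (hG x))
  refine isNullFun_divP (D.contDiff_V.differentiable (by norm_num)) D.integrable_weight i hφ'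
    (hF.mul hG) ?_ ?_ ?_
  · exact D.integrable (hφ.mul (hF0.mul hG0)) (by norm_num) (by simpa using hn) hs
  · simp only [hpd]
    exact D.integrable (hφ.mul ((hF1.mul hG0).add (hF0.mul hG1))) (by norm_num)
      (by simpa using hn) hs
  · exact D.integrable ((growth_mom i).mul (hφ.mul (hF0.mul hG0))) (by norm_num)
      (by simpa using hn) hs

theorem isNullFun_transport_sq (D : RegularData α V Γ g J h) {s : ℝ} (hs : s ∈ J) :
    IsNullFun (gibbs α V) (transport V (fun y => h s y * h s y)) := by
  have hpd : ∀ k x, pderiv k (fun y => h s y * h s y) x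
      = pderiv k (h s) x * h s x + h s x * pderiv k (h s) x := fun k x =>
    ((HasPDerivAt.of_differentiable (D.differentiable hs x) k).mul
      (HasPDerivAt.of_differentiable (D.differentiable hs x) k)).pderiv_eq
      ((D.differentiable hs x).mul (D.differentiable hs x))
  have hh := D.growth.mul D.growth
  have hh' := fun k => ((D.growth_pderiv k).mul D.growth).add (D.growth.mul (D.growth_pderiv k))
  refine isNullFun_transport D.contDiff_V D.integrable_weight
    ((D.differentiable hs).mul (D.differentiable hs)) (fun j => ?_) (fun j => ?_) (fun j => ?_)
    (fun j => ?_) fun j => ?_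
  · exact D.integrable ((growth_mom j).mul hh) (by norm_num) (by norm_num) hs
  · exact D.integrable ((growth_gradV D.contDiff_V j).mul hh) (by norm_num) (by norm_num) hs
  · simp only [hpd]
    exact D.integrable ((growth_mom j).mul (hh' _)) (by norm_num) (by norm_num) hs
  · simp only [hpd]
    exact D.integrable ((growth_gradV D.contDiff_V j).mul (hh' _)) (by norm_num) (by norm_num) hs
  · exact D.integrable ((growth_mom j).mul ((growth_gradV D.contDiff_V j).mul hh)) (by norm_num)
      (by norm_num) hs

theorem isNullFun_transport_self (D : RegularData α V Γ g J h) {s : ℝ} (hs : s ∈ J) :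
    IsNullFun (gibbs α V) (transport V (h s)) := by
  refine isNullFun_transport D.contDiff_V D.integrable_weight
    (D.differentiable hs) (fun j => ?_) (fun j => ?_) (fun j => ?_) (fun j => ?_) fun j => ?_
  · exact D.integrable_of_linear ((growth_mom j).mul D.growth) (by norm_num) (by norm_num) hs
  · exact D.integrable_of_linear ((growth_gradV D.contDiff_V j).mul D.growth) (by norm_num)
      (by norm_num) hs
  · exact D.integrable_of_linear ((growth_mom j).mul (D.growth_pderiv _)) (by norm_num)
      (by norm_num) hs
  · exact D.integrable_of_linear ((growth_gradV D.contDiff_V j).mul (D.growth_pderiv _))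
      (by norm_num) (by norm_num) hs
  -- The product p_j ∂_jV h is of degree two in u but only one in g, beyond the reach of
  -- `integrable_of_linear`.
  · exact D.integrable_mom_mul ((growth_gradV D.contDiff_V j).mul D.growth) (by norm_num)
      (by norm_num) hs j

theorem isNullFun_Γ_divP (D : RegularData α V Γ g J h) {s : ℝ} (hs : s ∈ J) (i j : Fin d) :
    IsNullFun (gibbs α V)
      (fun x => Γ (pos x) i j * divP α i (pderiv (Sum.inr j) (h s)) x) := by
  refine isNullFun_divP (D.contDiff_V.differentiable (by norm_num)) D.integrable_weight i
    (fun x => hasPDerivAt_comp_pos_inr (fun q => Γ q i j) x i)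
    (D.differentiable_pderiv hs _) ?_ ?_ ?_
  · exact D.integrable_of_linear ((growth_Γ D.contDiff_Γ i j).mul (D.growth_pderiv _))
      (by norm_num) (by norm_num) hs
  · exact D.integrable_of_linear ((growth_Γ D.contDiff_Γ i j).mul (D.growth_pderiv₂ _ _))
      (by norm_num) (by norm_num) hs
  · exact D.integrable_mom_mul ((growth_Γ D.contDiff_Γ i j).mul (D.growth_pderiv _)) (by norm_num)
      (by norm_num) hs i

theorem isNullFun_Γ_divP_mul (D : RegularData α V Γ g J h) {s : ℝ} (hs : s ∈ J) (i j : Fin d) :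
    IsNullFun (gibbs α V)
      (fun x => Γ (pos x) i j * divP α i (fun y => h s y * pderiv (Sum.inr j) (h s) y) x) :=
  D.isNullFun_mul_divP_mul (F := h)
    (G := fun s => pderiv (Sum.inr j) (h s)) hs i (by norm_num) (growth_Γ D.contDiff_Γ i j)
    (fun x => hasPDerivAt_comp_pos_inr (fun q => Γ q i j) x i) (D.differentiable hs)
    (D.differentiable_pderiv hs _) D.growth (D.growth_pderiv _) (D.growth_pderiv _)
    (D.growth_pderiv₂ _ _)

theorem isNullFun_dS_divP (D : RegularData α V Γ g J h) {s : ℝ} (hs : s ∈ J) (j : Fin d)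
    (k l : Fin d ⊕ Fin d) :
    IsNullFun (gibbs α V) (fun x => dS a b c Γ j k l (pos x)
      * divP α j (fun y => pderiv k (h s) y * pderiv l (h s) y) x) :=
  D.isNullFun_mul_divP_mul (F := fun s => pderiv k (h s))
    (G := fun s => pderiv l (h s)) hs j le_rfl (D.growth_dS j k l)
    (fun x => hasPDerivAt_comp_pos_inr (dS a b c Γ j k l) x j) (D.differentiable_pderiv hs _)
    (D.differentiable_pderiv hs _) (D.growth_pderiv _) (D.growth_pderiv _) (D.growth_pderiv₂ _ _)
    (D.growth_pderiv₂ _ _)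

theorem isNullFun_matS_Γ_divP (D : RegularData α V Γ g J h) {s : ℝ} (hs : s ∈ J)
    (k l : Fin d ⊕ Fin d) (i j : Fin d) :
    IsNullFun (gibbs α V) (fun x => (matS a b c Γ (pos x) k l * Γ (pos x) i j)
      * divP α i (fun y => pderiv l (h s) y * pderiv (Sum.inr j) (pderiv k (h s)) y) x) :=
  D.isNullFun_mul_divP_mul (F := fun s => pderiv l (h s))
    (G := fun s => pderiv (Sum.inr j) (pderiv k (h s))) hs i (by norm_num)
    ((D.growth_matS k l).mul (growth_Γ D.contDiff_Γ i j))
    (fun x => hasPDerivAt_comp_pos_inr (fun q => matS a b c Γ q k l * Γ q i j) x i)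
    (D.differentiable_pderiv hs _) (D.differentiable_pderiv₂ hs _ _) (D.growth_pderiv _)
    (D.growth_pderiv₂ _ _) (D.growth_pderiv₂ _ _) (D.growth_pderiv₃ _ _ _)

theorem isNullFun_matS_dGamma_divP (D : RegularData α V Γ g J h) {s : ℝ} (hs : s ∈ J)
    (k l : Fin d ⊕ Fin d) (i j : Fin d) :
    IsNullFun (gibbs α V) (fun x => (matS a b c Γ (pos x) k l * dGamma Γ k x i j)
      * divP α i (fun y => pderiv l (h s) y * pderiv (Sum.inr j) (h s) y) x) := by
  refine D.isNullFun_mul_divP_mul (F := fun s => pderiv l (h s))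
    (G := fun s => pderiv (Sum.inr j) (h s)) hs i (by norm_num)
    ((D.growth_matS k l).mul (growth_dGamma D.contDiff_Γ k i j)) (fun x => ?_)
    (D.differentiable_pderiv hs _) (D.differentiable_pderiv hs _) (D.growth_pderiv _)
    (D.growth_pderiv _) (D.growth_pderiv₂ _ _) (D.growth_pderiv₂ _ _)
  refine ((hasPDerivAt_comp_pos_inr (fun q => matS a b c Γ q k l) x i).mul
    (hasPDerivAt_dGamma_inr D.contDiff_Γ k i j i x)).congr_deriv (by ring)

/-- The heaviest terms are p_j ∂_jV S_kl ∂_k h ∂_l h, bounded by u² v² g², and p_j ∂_jS_kl ∂_k h ∂_l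
h, bounded by u v⁴ g². -/
theorem isNullFun_transport_matS (D : RegularData α V Γ g J h) {s : ℝ} (hs : s ∈ J)
    (k l : Fin d ⊕ Fin d) :
    IsNullFun (gibbs α V) (transport V
      (fun y => matS a b c Γ (pos y) k l * (pderiv k (h s) y * pderiv l (h s) y))) := by
  have hSd : Differentiable ℝ (fun q => matS a b c Γ q k l) :=
    (contDiff_matS a b c D.contDiff_Γ D.isUnit_det k l).differentiable (by norm_num)
  have hSd' : Differentiable ℝ (fun y : Phase d => matS a b c Γ (pos y) k l) :=
    hSd.comp ((contDiff_pos (n := 1)).differentiable (by norm_num))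
  have hdk := D.differentiable_pderiv hs k
  have hdl := D.differentiable_pderiv hs l
  have hpd : ∀ m x, pderiv m
      (fun y => matS a b c Γ (pos y) k l * (pderiv k (h s) y * pderiv l (h s) y)) x
      = Sum.elim (fun i => dS a b c Γ i k l (pos x)) (fun _ => 0) m
          * (pderiv k (h s) x * pderiv l (h s) x)
        + matS a b c Γ (pos x) k l * (pderiv m (pderiv k (h s)) x * pderiv l (h s) x
          + pderiv k (h s) x * pderiv m (pderiv l (h s)) x) := fun m x =>
    ((hasPDerivAt_comp_pos hSd m x).mul ((HasPDerivAt.of_differentiable (hdk x) m).mul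
      (HasPDerivAt.of_differentiable (hdl x) m))).pderiv_eq ((hSd' x).mul ((hdk x).mul (hdl x)))
  have hff := (D.growth_pderiv k).mul (D.growth_pderiv l)
  have hff' := fun m => ((D.growth_pderiv₂ m k).mul (D.growth_pderiv l)).add
    ((D.growth_pderiv k).mul (D.growth_pderiv₂ m l))
  have hF := (D.growth_matS (a := a) (b := b) (c := c) k l).mul hff
  refine isNullFun_transport D.contDiff_V D.integrable_weight
    (hSd'.mul (hdk.mul hdl)) (fun j => ?_) (fun j => ?_) (fun j => ?_)
    (fun j => ?_) fun j => ?_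
  · exact D.integrable ((growth_mom j).mul hF) (by norm_num) (by norm_num) hs
  · exact D.integrable ((growth_gradV D.contDiff_V j).mul hF) (by norm_num) (by norm_num) hs
  · simp only [hpd, Sum.elim_inl]
    exact D.integrable ((growth_mom j).mul (((D.growth_dS j k l).mul hff).add
      (D.growth_mono ((D.growth_matS k l).mul (hff' _)) le_rfl (by norm_num)))) (by norm_num)
      (by norm_num) hs
  · simp only [hpd, Sum.elim_inr, zero_mul, zero_add]
    exact D.integrable ((growth_gradV D.contDiff_V j).mul ((D.growth_matS k l).mul (hff' _)))
      (by norm_num) (by norm_num) hs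
  · exact D.integrable ((growth_mom j).mul ((growth_gradV D.contDiff_V j).mul hF)) (by norm_num)
      (by norm_num) hs

end RegularData

end NullTerms

/-! ### The pointwise identity for the gradient part, as finite sums. -/

section Algebra

variable {d : ℕ}

theorem sum_symm_mul {κ : Type*} [Fintype κ] {s : κ → κ → ℝ} (hs : ∀ k l, s k l = s l k)
    (u f : κ → ℝ) :
    ∑ k, ∑ l, s k l * (u k * f l + f k * u l) = 2 * ∑ k, ∑ l, s k l * (u k * f l) := by
  have h1 : ∑ k, ∑ l, s k l * (f k * u l) = ∑ k, ∑ l, s k l * (u k * f l) := by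
    rw [Finset.sum_comm]
    exact Finset.sum_congr rfl fun k _ => Finset.sum_congr rfl fun l _ => by rw [hs l k]; ring
  simp only [mul_add, Finset.sum_add_distrib, h1]
  ring

/-- The algebraic identity behind the dissipation formula of the gradient part. -/
theorem gradient_part_identity {κ : Type} [Fintype κ] {α : ℝ} (hα : α ≠ 0) {s : κ → κ → ℝ}
    (hs : ∀ k l, s k l = s l k) {dS : Fin d → κ → κ → ℝ} (hdS : ∀ j k l, dS j k l = dS j l k)
    {Γ : Fin d → Fin d → ℝ} (hΓ : ∀ i j, Γ i j = Γ j i) (dΓ : κ → Fin d → Fin d → ℝ)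
    (f T C dL : κ → ℝ) (p P : Fin d → ℝ) (H : κ → Fin d → ℝ) (D : κ → Fin d → Fin d → ℝ)
    (E : Fin d → Fin d → ℝ)
    (hdL : ∀ k, dL k = T k + α⁻¹ * ∑ i, ∑ j, Γ i j * D k i j
      + α⁻¹ * ∑ i, ∑ j, dΓ k i j * E i j + C k) :
    ∑ k, ∑ l, s k l * (dL k * f l + f k * dL l)
      + 2 * (-∑ k, ∑ l, s k l * (C k * f l)
        + α⁻¹ * ∑ l, ∑ i, (∑ k, s l k * ∑ j, dΓ k i j * P j) * H l i
        + α⁻¹ * ∑ k, ∑ j, (∑ i, H k i * Γ i j) * ∑ l, s k l * H l j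
        + α⁻¹ * ∑ k, ∑ j, (-∑ l, dS j k l * f l) * H k j)
      = ∑ k, ∑ l, ((-∑ j, p j * dS j k l) * (f k * f l) + s k l * (T k * f l + f k * T l))
        + -α⁻¹ * ∑ j, ∑ k, ∑ l, dS j k l * (H k j * f l + f k * (H l j - α * p j * f l))
        + 2 * α⁻¹ * ∑ k, ∑ l, ∑ i, ∑ j, s k l * Γ i j * (H l i * H k j + f l * D k i j)
        + 2 * α⁻¹ * ∑ k, ∑ l, ∑ i, ∑ j, s k l * dΓ k i j * (H l i * P j + f l * E i j) := by
  -- Symmetry of S reduces both halves of the time derivative to this sum, split into transport,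
  -- diffusion, ∂Γ and commutator contributions.
  have hL : ∑ k, ∑ l, s k l * (dL k * f l)
      = ∑ k, ∑ l, s k l * (T k * f l)
        + α⁻¹ * ∑ k, ∑ l, ∑ i, ∑ j, s k l * Γ i j * (f l * D k i j)
        + α⁻¹ * ∑ k, ∑ l, ∑ i, ∑ j, s k l * dΓ k i j * (f l * E i j)
        + ∑ k, ∑ l, s k l * (C k * f l) := by
    simp only [hdL, Finset.mul_sum, ← Finset.sum_add_distrib]
    refine Finset.sum_congr rfl fun k _ => Finset.sum_congr rfl fun l _ => ?_
    simp only [add_mul, mul_add, Finset.sum_mul, Finset.mul_sum]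
    congr 1
    congr 1
    congr 1
    all_goals exact Finset.sum_congr rfl fun i _ => Finset.sum_congr rfl fun j _ => by ring
  have hA : ∑ l, ∑ i, (∑ k, s l k * ∑ j, dΓ k i j * P j) * H l i
      = ∑ k, ∑ l, ∑ i, ∑ j, s k l * dΓ k i j * (H l i * P j) := by
    rw [Finset.sum_comm (s := (Finset.univ : Finset κ)) (t := (Finset.univ : Finset κ))]
    refine Finset.sum_congr rfl fun l _ => ?_
    rw [Finset.sum_comm (s := (Finset.univ : Finset κ)) (t := (Finset.univ : Finset (Fin d)))]
    refine Finset.sum_congr rfl fun i _ => ?_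
    rw [Finset.sum_mul]
    refine Finset.sum_congr rfl fun k _ => ?_
    rw [Finset.mul_sum, Finset.sum_mul]
    exact Finset.sum_congr rfl fun j _ => by rw [hs l k]; ring
  have hH : ∑ k, ∑ j, (∑ i, H k i * Γ i j) * ∑ l, s k l * H l j
      = ∑ k, ∑ l, ∑ i, ∑ j, s k l * Γ i j * (H l i * H k j) := by
    refine Finset.sum_congr rfl fun k _ => ?_
    rw [Finset.sum_comm (s := (Finset.univ : Finset κ)) (t := (Finset.univ : Finset (Fin d)))]
    refine Finset.sum_congr rfl fun j _ => ?_
    rw [Finset.mul_sum]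
    refine Finset.sum_congr rfl fun l _ => ?_
    rw [Finset.sum_mul]
    exact Finset.sum_congr rfl fun i _ => by rw [hΓ i j]; ring
  have hB : ∑ k, ∑ j, (-∑ l, dS j k l * f l) * H k j
      = -∑ j, ∑ k, ∑ l, dS j k l * (H k j * f l) := by
    rw [Finset.sum_comm, ← Finset.sum_neg_distrib]
    refine Finset.sum_congr rfl fun j _ => ?_
    rw [← Finset.sum_neg_distrib]
    refine Finset.sum_congr rfl fun k _ => ?_
    rw [neg_mul, Finset.sum_mul]
    congr 1
    exact Finset.sum_congr rfl fun l _ => by ring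
  have h3 : ∑ k, ∑ l, ((-∑ j, p j * dS j k l) * (f k * f l) + s k l * (T k * f l + f k * T l))
      = -(∑ j, ∑ k, ∑ l, dS j k l * (p j * (f k * f l)))
        + 2 * ∑ k, ∑ l, s k l * (T k * f l) := by
    rw [← sum_symm_mul hs]
    simp only [Finset.sum_add_distrib]
    congr 1
    rw [Finset.sum_comm (s := (Finset.univ : Finset (Fin d))), ← Finset.sum_neg_distrib]
    refine Finset.sum_congr rfl fun k _ => ?_
    rw [Finset.sum_comm, ← Finset.sum_neg_distrib]
    refine Finset.sum_congr rfl fun l _ => ?_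
    rw [neg_mul, Finset.sum_mul]
    congr 1
    exact Finset.sum_congr rfl fun j _ => by ring
  -- With the weight -α⁻¹ of this null term, its part in α p_j cancels the transport of S in `h3`,
  -- and only the B-term remains.
  have h4 : ∑ j, ∑ k, ∑ l, dS j k l * (H k j * f l + f k * (H l j - α * p j * f l))
      = 2 * ∑ j, ∑ k, ∑ l, dS j k l * (H k j * f l)
        - α * ∑ j, ∑ k, ∑ l, dS j k l * (p j * (f k * f l)) := by
    simp only [Finset.mul_sum (s := (Finset.univ : Finset (Fin d))), ← Finset.sum_sub_distrib]
    refine Finset.sum_congr rfl fun j _ => ?_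
    rw [← sum_symm_mul (hdS j) (fun k => H k j)]
    simp only [Finset.mul_sum, ← Finset.sum_sub_distrib]
    exact Finset.sum_congr rfl fun k _ => Finset.sum_congr rfl fun l _ => by ring
  rw [sum_symm_mul hs, hL, hA, hH, hB, h3, h4]
  simp only [mul_add (_ * _ : ℝ), Finset.sum_add_distrib]
  field_simp
  ring

end Algebra

/-! ### Assembly of the rate from the commutators and the null terms. -/

section Rate

variable {d : ℕ}

theorem mulVec_dotProduct_of_isSymm {M : Matrix (Fin d) (Fin d) ℝ} (hM : M.IsSymm)
    (u v : Fin d → ℝ) : (M *ᵥ u) ⬝ᵥ v = u ⬝ᵥ (M *ᵥ v) := by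
  rw [Matrix.dotProduct_mulVec, ← Matrix.mulVec_transpose, hM.eq]

/-- Expand the pairing of the commutator vector (W P, -Q - G P) with S(Q, P) by blocks. Symmetry of
G and W moves all matrices to one side; no commutation of G with W is used, so the order W G⁻² in
the mixed term is forced. -/
theorem commutator_identity (a b c : ℝ) {G W : Matrix (Fin d) (Fin d) ℝ} (hG : G.IsSymm)
    (hW : W.IsSymm) (hdet : IsUnit G.det) (Q P : Fin d → ℝ) :
    Sum.elim (W *ᵥ P) (-Q - G *ᵥ P) ⬝ᵥ
        (Matrix.fromBlocks (b • (G⁻¹ * G⁻¹)) (a • G⁻¹) (a • G⁻¹) (c • 1) *ᵥ Sum.elim Q P)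
      = -(P ⬝ᵥ ((c • G - (a • G⁻¹) * W) *ᵥ P) + Q ⬝ᵥ ((a • G⁻¹) *ᵥ Q)
        + P ⬝ᵥ (((a • G⁻¹) * G + c • 1 - W * (b • (G⁻¹ * G⁻¹))) *ᵥ Q)) := by
  have hGi : (G⁻¹).IsSymm := by
    rw [Matrix.IsSymm, Matrix.transpose_nonsing_inv, hG.eq]
  have h1 : (W *ᵥ P) ⬝ᵥ ((G⁻¹ * G⁻¹) *ᵥ Q) = P ⬝ᵥ ((W * (G⁻¹ * G⁻¹)) *ᵥ Q) := by
    rw [mulVec_dotProduct_of_isSymm hW, Matrix.mulVec_mulVec]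
  have h2 : (W *ᵥ P) ⬝ᵥ (G⁻¹ *ᵥ P) = P ⬝ᵥ ((G⁻¹ * W) *ᵥ P) := by
    rw [← mulVec_dotProduct_of_isSymm hGi, Matrix.mulVec_mulVec, dotProduct_comm]
  have h3 : (G *ᵥ P) ⬝ᵥ (G⁻¹ *ᵥ Q) = P ⬝ᵥ Q := by
    rw [mulVec_dotProduct_of_isSymm hG, Matrix.mulVec_mulVec, Matrix.mul_nonsing_inv _ hdet,
      Matrix.one_mulVec]
  have h4 : (G *ᵥ P) ⬝ᵥ P = P ⬝ᵥ (G *ᵥ P) := dotProduct_comm _ _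
  have h5 : Q ⬝ᵥ P = P ⬝ᵥ Q := dotProduct_comm _ _
  rw [Matrix.fromBlocks_mulVec]
  simp only [Sum.elim_comp_inl, Sum.elim_comp_inr, sumElim_dotProduct_sumElim,
    Matrix.smul_mulVec, Matrix.one_mulVec, dotProduct_add, dotProduct_smul, sub_dotProduct,
    neg_dotProduct, smul_eq_mul, Matrix.sub_mulVec, Matrix.add_mulVec, dotProduct_sub,
    Matrix.smul_mul, Matrix.mul_smul, Matrix.nonsing_inv_mul _ hdet, h1, h2, h3, h4, h5]
  ring

variable {α a b c : ℝ} {V : Pos d → ℝ} {Γ : Pos d → Matrix (Fin d) (Fin d) ℝ}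

theorem grad_dotProduct_matS (h : Phase d → ℝ) (x : Phase d) :
    grad h x ⬝ᵥ (matS a b c Γ (pos x) *ᵥ grad h x)
      = ∑ k, ∑ l, matS a b c Γ (pos x) k l * (pderiv k h x * pderiv l h x) := by
  simp only [dotProduct, Matrix.mulVec, grad, Finset.mul_sum]
  exact Finset.sum_congr rfl fun k _ => Finset.sum_congr rfl fun l _ => by ring

theorem sum_matS_commTerm (hV : ContDiff ℝ 2 V) (hΓs : ∀ q, (Γ q).IsSymm)
    (hinv : ∀ q, IsUnit (Γ q).det) (h : Phase d → ℝ) (x : Phase d) :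
    ∑ k, ∑ l, matS a b c Γ (pos x) k l * (commTerm V Γ k h x * pderiv l h x)
      = -(gradP h x ⬝ᵥ ((c • Γ (pos x) - (a • (Γ (pos x))⁻¹) * hess V (pos x)) *ᵥ gradP h x)
        + gradQ h x ⬝ᵥ ((a • (Γ (pos x))⁻¹) *ᵥ gradQ h x)
        + gradP h x ⬝ᵥ (((a • (Γ (pos x))⁻¹) * Γ (pos x) + c • 1
          - hess V (pos x) * (b • ((Γ (pos x))⁻¹ * (Γ (pos x))⁻¹))) *ᵥ gradQ h x)) := by
  have hW : (hess V (pos x)).IsSymm := by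
    ext i j
    exact pderiv_comm hV j i (pos x)
  rw [← commutator_identity a b c (hΓs _) hW (hinv _)]
  have hC : (fun k => commTerm V Γ k h x)
      = Sum.elim (hess V (pos x) *ᵥ gradP h x) (-gradQ h x - Γ (pos x) *ᵥ gradP h x) := by
    ext k
    rcases k with k | k <;> simp [commTerm, Matrix.mulVec, dotProduct, gradP, gradQ]
  have hf : (fun k => pderiv k h x) = Sum.elim (gradQ h x) (gradP h x) := by
    ext k
    rcases k with k | k <;> rfl
  rw [← hC, ← hf]
  change _ = (fun k => commTerm V Γ k h x) ⬝ᵥ (matS a b c Γ (pos x) *ᵥ fun k => pderiv k h x)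
  simp only [dotProduct, Matrix.mulVec, Finset.mul_sum]
  exact Finset.sum_congr rfl fun k _ => Finset.sum_congr rfl fun l _ => by ring

theorem matS_symm (hΓs : ∀ q, (Γ q).IsSymm) (q : Pos d) (k l : Fin d ⊕ Fin d) :
    matS a b c Γ q k l = matS a b c Γ q l k := by
  have hGi : ((Γ q)⁻¹).IsSymm := by
    rw [Matrix.IsSymm, Matrix.transpose_nonsing_inv, (hΓs q).eq]
  have hS : (matS a b c Γ q).IsSymm := by
    refine Matrix.IsSymm.fromBlocks ?_ ?_ ?_
    · rw [Matrix.IsSymm, Matrix.transpose_smul, Matrix.transpose_mul, hGi.eq]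
    · rw [Matrix.transpose_smul, hGi.eq]
    · rw [Matrix.IsSymm, Matrix.transpose_smul, Matrix.transpose_one]
  exact hS.apply l k

namespace RegularData

variable {g : Phase d → ℝ} {J : Set ℝ} {h : ℝ → Phase d → ℝ}

/-- The dissipation formula in integrated form: twice the rate compensates the time derivative of
the integrand of the Lyapunov functional up to a function with vanishing integral. -/
theorem isNullFun_rate (D : RegularData α V Γ g J h) (hΓs : ∀ q, (Γ q).IsSymm) {s : ℝ}
    (hs : s ∈ J) :
    IsNullFun (gibbs α V) (fun x => 2 * ((h s x - 1) * gen α V Γ (h s) x)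
      + ∑ k, ∑ l, matS a b c Γ (pos x) k l * (dgen α V Γ k (h s) x * pderiv l (h s) x
        + pderiv k (h s) x * dgen α V Γ l (h s) x)
      + 2 * rateIntegrand α a b c V Γ
        (fun q => hess V q * (b • ((Γ q)⁻¹ * (Γ q)⁻¹))) (h s) x) := by
  have hα : α ≠ 0 := D.α_pos.ne'
  have hSd : ∀ k l, Differentiable ℝ (fun q => matS a b c Γ q k l) := fun k l =>
    (contDiff_matS a b c D.contDiff_Γ D.isUnit_det k l).differentiable (by norm_num)
  have hSd' : ∀ k l, Differentiable ℝ (fun y : Phase d => matS a b c Γ (pos y) k l) := fun k l =>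
    (hSd k l).comp ((contDiff_pos (n := 1)).differentiable (by norm_num))
  have hd0 := D.differentiable hs
  have hd1 := fun k => D.differentiable_pderiv hs k
  have hd2 := fun k l => D.differentiable_pderiv₂ hs k l
  -- The terms n1–n4 handle the χ² part, n1 and n3 for the factor h and n2 and n4 for the factor -1.
  -- The terms n5–n8 handle transport, p·∂_qS, diffusion and ∂Γ in the gradient part.
  have n1 := D.isNullFun_transport_sq hs
  have n2 := (D.isNullFun_transport_self hs).const_mul (-2)
  have n3 := (IsNullFun.sum (s := Finset.univ) fun i _ => IsNullFun.sum (s := Finset.univ)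
    fun j _ => D.isNullFun_Γ_divP_mul hs i j).const_mul (2 * α⁻¹)
  have n4 := (IsNullFun.sum (s := Finset.univ) fun i _ => IsNullFun.sum (s := Finset.univ)
    fun j _ => D.isNullFun_Γ_divP hs i j).const_mul (-2 * α⁻¹)
  have n5 := IsNullFun.sum (s := Finset.univ) fun k _ => IsNullFun.sum (s := Finset.univ)
    fun l _ => D.isNullFun_transport_matS (a := a) (b := b) (c := c) hs k l
  have n6 := (IsNullFun.sum (s := Finset.univ) fun j _ => IsNullFun.sum (s := Finset.univ)
    fun k _ => IsNullFun.sum (s := Finset.univ)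
    fun l _ => D.isNullFun_dS_divP (a := a) (b := b) (c := c) hs j k l).const_mul (-α⁻¹)
  have n7 := (IsNullFun.sum (s := Finset.univ) fun k _ => IsNullFun.sum (s := Finset.univ)
    fun l _ => IsNullFun.sum (s := Finset.univ) fun i _ => IsNullFun.sum (s := Finset.univ)
    fun j _ => D.isNullFun_matS_Γ_divP (a := a) (b := b) (c := c) hs k l i j).const_mul (2 * α⁻¹)
  have n8 := (IsNullFun.sum (s := Finset.univ) fun k _ => IsNullFun.sum (s := Finset.univ)
    fun l _ => IsNullFun.sum (s := Finset.univ) fun i _ => IsNullFun.sum (s := Finset.univ)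
    fun j _ => D.isNullFun_matS_dGamma_divP (a := a) (b := b) (c := c) hs k l i j).const_mul
      (2 * α⁻¹)
  refine ((((n1.add n2).add n3).add n4).add (((n5.add n6).add n7).add n8)).congr fun x => ?_
  have hchi : 2 * ((h s x - 1) * gen α V Γ (h s) x)
      + 2 * (α⁻¹ * (gradP (h s) x ⬝ᵥ (Γ (pos x) *ᵥ gradP (h s) x)))
      = transport V (fun y => h s y * h s y) x + -2 * transport V (h s) x
        + 2 * α⁻¹ * ∑ i, ∑ j, Γ (pos x) i j
          * divP α i (fun y => h s y * pderiv (Sum.inr j) (h s) y) x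
        + -2 * α⁻¹ * ∑ i, ∑ j, Γ (pos x) i j * divP α i (pderiv (Sum.inr j) (h s)) x := by
    have e1 : ∑ i, ∑ j, Γ (pos x) i j
          * divP α i (fun y => h s y * pderiv (Sum.inr j) (h s) y) x
        = gradP (h s) x ⬝ᵥ (Γ (pos x) *ᵥ gradP (h s) x)
          + h s x * ∑ i, ∑ j, Γ (pos x) i j * divP α i (pderiv (Sum.inr j) (h s)) x := by
      simp only [divP_mul hd0 (hd1 _), dotProduct, Matrix.mulVec, gradP, Finset.mul_sum,
        ← Finset.sum_add_distrib]
      exact Finset.sum_congr rfl fun k _ => Finset.sum_congr rfl fun l _ => by ring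
    rw [e1, transport_mul hd0 hd0, gen]
    ring
  have hgrad := gradient_part_identity hα (s := matS a b c Γ (pos x))
    (fun k l => matS_symm hΓs (pos x) k l) (dS := fun j k l => dS a b c Γ j k l (pos x))
    (fun j k l => by simp only [dS, matS_symm hΓs _ k l]) (Γ := Γ (pos x))
    (fun i j => (hΓs (pos x)).apply j i) (fun k => dGamma Γ k x) (fun k => pderiv k (h s) x)
    (fun k => transport V (pderiv k (h s)) x) (fun k => commTerm V Γ k (h s) x)
    (fun k => dgen α V Γ k (h s) x) (fun j => mom x j) (gradP (h s) x) (hessPX (h s) x)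
    (fun k i j => divP α i (pderiv (Sum.inr j) (pderiv k (h s))) x)
    (fun i j => divP α i (pderiv (Sum.inr j) (h s)) x) (fun k => rfl)
  -- The α⁻¹Γ term is separated because it belongs to the χ² part; all the rest belongs to the
  -- gradient part.
  have hrate : rateIntegrand α a b c V Γ
        (fun q => hess V q * (b • ((Γ q)⁻¹ * (Γ q)⁻¹))) (h s) x
      = α⁻¹ * (gradP (h s) x ⬝ᵥ (Γ (pos x) *ᵥ gradP (h s) x))
        + (-∑ k, ∑ l, matS a b c Γ (pos x) k l
            * (commTerm V Γ k (h s) x * pderiv l (h s) x)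
          + α⁻¹ * ∑ l, ∑ i, (∑ k, matS a b c Γ (pos x) l k
            * ∑ j, dGamma Γ k x i j * gradP (h s) x j) * hessPX (h s) x l i
          + α⁻¹ * ∑ k, ∑ j, (∑ i, hessPX (h s) x k i * Γ (pos x) i j)
            * ∑ l, matS a b c Γ (pos x) k l * hessPX (h s) x l j
          + α⁻¹ * ∑ k, ∑ j, (-∑ l, dS a b c Γ j k l (pos x) * pderiv l (h s) x)
            * hessPX (h s) x k j) := by
    rw [sum_matS_commTerm D.contDiff_V hΓs D.isUnit_det]
    have hB : ∀ k j, matB a b c Γ (h s) x k j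
        = -∑ l, dS a b c Γ j k l (pos x) * pderiv l (h s) x := fun k j => by
      simp only [matB, Matrix.of_apply, dS, pderiv_comp_pos_inl (hSd _ _)]
    have hA : ∀ k i, matA Γ (h s) x k i = ∑ j, dGamma Γ k x i j * gradP (h s) x j :=
      fun k i => rfl
    have hsplit : gradP (h s) x ⬝ᵥ ((α⁻¹ • Γ (pos x) + c • Γ (pos x)
          - (a • (Γ (pos x))⁻¹) * hess V (pos x)) *ᵥ gradP (h s) x)
        = α⁻¹ * (gradP (h s) x ⬝ᵥ (Γ (pos x) *ᵥ gradP (h s) x))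
          + gradP (h s) x ⬝ᵥ ((c • Γ (pos x) - (a • (Γ (pos x))⁻¹) * hess V (pos x))
            *ᵥ gradP (h s) x) := by
      rw [add_sub_assoc, Matrix.add_mulVec, dotProduct_add, Matrix.smul_mulVec, dotProduct_smul,
        smul_eq_mul]
    simp only [rateIntegrand, frob, Matrix.mul_apply (M := matS a b c Γ (pos x)),
      Matrix.mul_apply (N := Γ (pos x)) (M := hessPX (h s) x), hA, hB, hsplit]
    ring
  have z5 : ∀ k l, transport V
        (fun y => matS a b c Γ (pos y) k l * (pderiv k (h s) y * pderiv l (h s) y)) x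
      = (-∑ j, mom x j * dS a b c Γ j k l (pos x)) * (pderiv k (h s) x * pderiv l (h s) x)
        + matS a b c Γ (pos x) k l * (transport V (pderiv k (h s)) x * pderiv l (h s) x
          + pderiv k (h s) x * transport V (pderiv l (h s)) x) := fun k l => by
    rw [transport_mul (G := fun y => pderiv k (h s) y * pderiv l (h s) y) (hSd' k l)
      ((hd1 k).mul (hd1 l)), transport_mul (hd1 k) (hd1 l),
      transport_comp_pos (hSd k l)]
    rfl
  have z6 : ∀ j k l, divP α j (fun y => pderiv k (h s) y * pderiv l (h s) y) x
      = hessPX (h s) x k j * pderiv l (h s) x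
        + pderiv k (h s) x * (hessPX (h s) x l j - α * mom x j * pderiv l (h s) x) :=
    fun j k l => divP_mul (hd1 k) (hd1 l) j x
  have z7 : ∀ k l i j, divP α i
        (fun y => pderiv l (h s) y * pderiv (Sum.inr j) (pderiv k (h s)) y) x
      = hessPX (h s) x l i * hessPX (h s) x k j
        + pderiv l (h s) x * divP α i (pderiv (Sum.inr j) (pderiv k (h s))) x :=
    fun k l i j => divP_mul (hd1 l) (hd2 _ k) i x
  have z8 : ∀ l i j, divP α i
        (fun y => pderiv l (h s) y * pderiv (Sum.inr j) (h s) y) x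
      = hessPX (h s) x l i * gradP (h s) x j
        + pderiv l (h s) x * divP α i (pderiv (Sum.inr j) (h s)) x :=
    fun l i j => divP_mul (hd1 l) (hd1 _) i x
  -- The rule `z6` waits for the next call: it would also match the products treated by `z8` and
  -- expand their second factor further than `hgrad` does.
  simp only [z5, z7, z8]
  simp only [z6]
  rw [← hchi, ← hgrad, hrate]
  ring

end RegularData

end Rate

/-! ### Time derivatives of ∂_k h and of the two integrals. -/

section TimeDerivative

variable {d : ℕ} {α a b c : ℝ} {V : Pos d → ℝ} {Γ : Pos d → Matrix (Fin d) (Fin d) ℝ}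

theorem continuousOn_mpderiv {ι : Type} [Fintype ι] [DecidableEq ι] {I : Set ℝ}
    {h : ℝ → EuclideanSpace ℝ ι → ℝ} {n : ℕ}
    (hc : ContinuousOn (fun z : ℝ × EuclideanSpace ℝ ι => iteratedFDeriv ℝ n (h z.1) z.2)
      (I ×ˢ Set.univ)) (w : Fin n → ι) :
    ContinuousOn (fun z : ℝ × EuclideanSpace ℝ ι => mpderiv w (h z.1) z.2) (I ×ˢ Set.univ) :=
  (ContinuousMultilinearMap.apply ℝ (fun _ : Fin n => EuclideanSpace ℝ ι) ℝ
    (fun k => EuclideanSpace.single (w k) 1)).continuous.comp_continuousOn hc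

/-- Supplies the joint continuity that the interchange of ∂_t and ∂_k needs. Third derivatives of h
enter here through L ∂_k h. -/
theorem continuousOn_dgen (hV : ContDiff ℝ 2 V) (hΓ : ∀ i j, ContDiff ℝ 1 (fun q => Γ q i j))
    {I : Set ℝ} {h : ℝ → Phase d → ℝ} (hreg : IsRegularFamily α V Γ I h) (k : Fin d ⊕ Fin d) :
    ContinuousOn (fun z : ℝ × Phase d => dgen α V Γ k (h z.1) z.2) (I ×ˢ Set.univ) := by
  have h1 : ∀ i, ContinuousOn (fun z : ℝ × Phase d => pderiv i (h z.1) z.2)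
      (I ×ˢ Set.univ) := fun i =>
    (continuousOn_mpderiv (hreg.continuousOn 1 (by norm_num)) ![i]).congr fun z hz => by
      rw [pderiv_eq_mpderiv ((hreg.contDiff z.1 hz.1).of_le (by norm_num))]
  have h2 : ∀ i j, ContinuousOn (fun z : ℝ × Phase d => pderiv i (pderiv j (h z.1)) z.2)
      (I ×ˢ Set.univ) := fun i j =>
    (continuousOn_mpderiv (hreg.continuousOn 2 (by norm_num)) ![i, j]).congr fun z hz => by
      rw [pderiv_pderiv_eq_mpderiv ((hreg.contDiff z.1 hz.1).of_le (by norm_num))]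
  have h3 : ∀ i j l, ContinuousOn
      (fun z : ℝ × Phase d => pderiv i (pderiv j (pderiv l (h z.1))) z.2)
      (I ×ˢ Set.univ) := fun i j l =>
    (continuousOn_mpderiv (hreg.continuousOn 3 (by norm_num)) ![i, j, l]).congr fun z hz => by
      rw [pderiv_pderiv_pderiv_eq_mpderiv (hreg.contDiff z.1 hz.1)]
  have hposc : Continuous (fun z : ℝ × Phase d => pos z.2) :=
    (contDiff_pos (n := 0)).continuous.comp continuous_snd
  have hm : ∀ j, Continuous (fun z : ℝ × Phase d => mom z.2 j) := fun j =>
    (contDiff_mom_apply (n := 0) j).continuous.comp continuous_snd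
  have hgV : ∀ j, Continuous (fun z : ℝ × Phase d => pderiv j V (pos z.2)) := fun j =>
    (contDiff_pderiv (n := 1) (by exact_mod_cast hV) j).continuous.comp hposc
  have hhV : ∀ i j, Continuous (fun z : ℝ × Phase d => hess V (pos z.2) i j) := fun i j =>
    (contDiff_pderiv (n := 0) (contDiff_pderiv (n := 1) (by exact_mod_cast hV) j)
      i).continuous.comp hposc
  have hΓc : ∀ i j, Continuous (fun z : ℝ × Phase d => Γ (pos z.2) i j) := fun i j =>
    (hΓ i j).continuous.comp hposc
  have hdΓ : ∀ i j, Continuous (fun z : ℝ × Phase d => dGamma Γ k z.2 i j) := fun i j =>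
    (contDiff_pderiv (n := 0) (by exact_mod_cast (hΓ i j).comp contDiff_pos)
      k).continuous.comp continuous_snd
  have hdiv : ∀ (i : Fin d) (F : ℝ → Phase d → ℝ),
      ContinuousOn (fun z : ℝ × Phase d => F z.1 z.2) (I ×ˢ Set.univ) →
      ContinuousOn (fun z : ℝ × Phase d => pderiv (Sum.inr i) (F z.1) z.2) (I ×ˢ Set.univ) →
      ContinuousOn (fun z : ℝ × Phase d => divP α i (F z.1) z.2) (I ×ˢ Set.univ) :=
    fun i F hF hF' => hF'.sub ((continuous_const.mul (hm i)).continuousOn.mul hF)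
  have hgen : ContinuousOn (fun z : ℝ × Phase d => gen α V Γ (pderiv k (h z.1)) z.2)
      (I ×ˢ Set.univ) :=
    (continuousOn_finsetSum _ fun j _ => ((hm j).neg.continuousOn.mul (h2 (Sum.inl j) k)).add
      ((hgV j).continuousOn.mul (h2 (Sum.inr j) k))).add
    (continuousOn_const.mul (continuousOn_finsetSum _ fun i _ => continuousOn_finsetSum _
      fun j _ => (hΓc i j).continuousOn.mul
        (hdiv i (fun s => pderiv (Sum.inr j) (pderiv k (h s))) (h2 _ k) (h3 _ _ k))))
  have hfric : ContinuousOn (fun z : ℝ × Phase d => α⁻¹ * ∑ i, ∑ j, dGamma Γ k z.2 i j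
      * divP α i (pderiv (Sum.inr j) (h z.1)) z.2) (I ×ˢ Set.univ) :=
    continuousOn_const.mul (continuousOn_finsetSum _ fun i _ => continuousOn_finsetSum _
      fun j _ => (hdΓ i j).continuousOn.mul
        (hdiv i (fun s => pderiv (Sum.inr j) (h s)) (h1 _) (h2 _ _)))
  refine (hgen.add hfric).add ?_
  rcases k with k | k
  · have h4 : ContinuousOn (fun z : ℝ × Phase d =>
        ∑ j, hess V (pos z.2) k j * pderiv (Sum.inr j) (h z.1) z.2) (I ×ˢ Set.univ) :=
      continuousOn_finsetSum _ fun j _ => (hhV k j).continuousOn.mul (h1 (Sum.inr j))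
    exact h4
  · exact (h1 (Sum.inl k)).neg.sub
      (continuousOn_finsetSum _ fun j _ => (hΓc k j).continuousOn.mul (h1 (Sum.inr j)))

theorem hasDerivAt_pderiv_relDensity (hα : α ≠ 0) (hV : ContDiff ℝ 2 V)
    (hZ : Integrable (gibbsWeight α V)) (hΓ : ∀ i j, ContDiff ℝ 1 (fun q => Γ q i j)) {I : Set ℝ}
    (hI : IsOpen I) {ρ : ℝ → Phase d → ℝ} (hFP : SolvesFokkerPlanck α V Γ I ρ)
    (hreg : IsRegularFamily α V Γ I (fun t => relDensity α V (ρ t))) {t : ℝ} (ht : t ∈ I)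
    (k : Fin d ⊕ Fin d) (x : Phase d) :
    HasDerivAt (fun s => pderiv k (relDensity α V (ρ s)) x)
      (dgen α V Γ k (relDensity α V (ρ t)) x) t := by
  refine hasDerivAt_pderiv_of_continuousAt (f := fun s => relDensity α V (ρ s))
    (ψ := fun s => gen α V Γ (relDensity α V (ρ s)))
    (ψ' := fun s => dgen α V Γ k (relDensity α V (ρ s)))
    (fi := fun s => pderiv k (relDensity α V (ρ s))) (i := k) hI ht
    (fun s hs y => hasDerivAt_relDensity hα hV hZ hΓ hFP hs (hreg.contDiff s hs) y)
    (fun s hs => HasPDerivAt.of_differentiable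
      ((hreg.contDiff s hs).differentiable (by norm_num) x) k)
    (fun s hs y => hasPDerivAt_gen hα hV hΓ (hreg.contDiff s hs) k y) ?_
  exact (continuousOn_dgen hV hΓ hreg k).continuousAt
    ((hI.prod isOpen_univ).mem_nhds ⟨ht, Set.mem_univ _⟩)

namespace RegularData

variable {g : Phase d → ℝ} {J : Set ℝ} {h : ℝ → Phase d → ℝ}

theorem memLp_self (D : RegularData α V Γ g J h) {s : ℝ} (hs : s ∈ J) :
    MemLp (h s) 2 (gibbs α V) := D.memLp D.growth (by norm_num) (by norm_num) hs

theorem integrable_sub_one_sq (D : RegularData α V Γ g J h) {s : ℝ} (hs : s ∈ J) :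
    Integrable (fun x => (h s x - 1) ^ 2) (gibbs α V) := by
  have := isFiniteMeasure_gibbs D.integrable_weight
  exact ((D.memLp_self hs).sub (memLp_const 1)).integrable_sq

theorem growth_grad_matS (D : RegularData α V Γ g J h) :
    GrowthBound (sizeV V) (sizeΓ Γ) g J 0 2 2
      (fun s x => ∑ k, ∑ l, matS a b c Γ (pos x) k l * (pderiv k (h s) x * pderiv l (h s) x)) :=
  GrowthBound.sum fun k _ => GrowthBound.sum fun l _ =>
    (D.growth_matS k l).mul ((D.growth_pderiv k).mul (D.growth_pderiv l))

theorem hasDerivAt_integral_sub_one_sq (D : RegularData α V Γ g J h)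
    (hderiv : ∀ s ∈ J, ∀ x, HasDerivAt (fun r => h r x) (gen α V Γ (h s) x) s) {t : ℝ}
    (hJ : J ∈ 𝓝 t) :
    Integrable (fun x => 2 * ((h t x - 1) * gen α V Γ (h t) x)) (gibbs α V) ∧
    HasDerivAt (fun s => ∫ x, (h s x - 1) ^ 2 ∂(gibbs α V))
      (∫ x, 2 * ((h t x - 1) * gen α V Γ (h t) x) ∂(gibbs α V)) t := by
  have := isFiniteMeasure_gibbs D.integrable_weight
  have htJ : t ∈ J := mem_of_mem_nhds hJ
  have hgen := D.growth_gen D.growth_pderiv D.growth_pderiv₂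
  obtain ⟨B₁, hB₁, hb₁⟩ := (D.growth.mul hgen).exists_integrable_bound one_le_sizeV one_le_sizeΓ
    D.nonneg D.memLp_bound (by norm_num) (by norm_num)
  obtain ⟨B₂, hB₂, hb₂⟩ := hgen.exists_memLp_bound one_le_sizeV one_le_sizeΓ
    D.nonneg D.memLp_bound (by norm_num) (by norm_num)
  refine hasDerivAt_integral_of_dominated_loc_of_deriv_le (s := J)
    (F := fun s x => (h s x - 1) ^ 2) (F' := fun s x => 2 * ((h s x - 1) * gen α V Γ (h s) x))
    (bound := fun x => 2 * (B₁ x + B₂ x)) hJ ?_ (D.integrable_sub_one_sq htJ) ?_ ?_ ?_ ?_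
  · filter_upwards [hJ] with s hs
    exact (D.integrable_sub_one_sq hs).aestronglyMeasurable
  · exact (continuous_const.mul (((D.contDiff t htJ).continuous.sub continuous_const).mul
      (hgen.cont t htJ))).aestronglyMeasurable
  · refine Eventually.of_forall fun x s hs => ?_
    have h1 := hb₁ s hs x
    have h2 := hb₂ s hs x
    -- The two parts have different degrees in g: h·L h has an integrable bound, while L h has an L²
    -- bound, integrable since π is finite.
    have h3 : 2 * ((h s x - 1) * gen α V Γ (h s) x)
        = 2 * (h s x * gen α V Γ (h s) x - gen α V Γ (h s) x) := by ring
    rw [h3, norm_mul, Real.norm_of_nonneg (zero_le_two (α := ℝ))]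
    exact mul_le_mul_of_nonneg_left ((norm_sub_le _ _).trans (add_le_add h1 h2)) zero_le_two
  · exact (hB₁.add (hB₂.integrable (by norm_num))).const_mul 2
  · refine Eventually.of_forall fun x s hs => ?_
    refine (((hderiv s hs x).sub_const 1).pow 2).congr_deriv ?_
    norm_num
    ring

theorem hasDerivAt_integral_grad (D : RegularData α V Γ g J h)
    (hderiv : ∀ s ∈ J, ∀ k x, HasDerivAt (fun r => pderiv k (h r) x) (dgen α V Γ k (h s) x) s)
    {t : ℝ} (hJ : J ∈ 𝓝 t) :
    Integrable (fun x => ∑ k, ∑ l, matS a b c Γ (pos x) k l *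
      (dgen α V Γ k (h t) x * pderiv l (h t) x + pderiv k (h t) x * dgen α V Γ l (h t) x))
      (gibbs α V) ∧
    HasDerivAt (fun s => ∫ x, ∑ k, ∑ l, matS a b c Γ (pos x) k l
        * (pderiv k (h s) x * pderiv l (h s) x) ∂(gibbs α V))
      (∫ x, ∑ k, ∑ l, matS a b c Γ (pos x) k l *
        (dgen α V Γ k (h t) x * pderiv l (h t) x + pderiv k (h t) x * dgen α V Γ l (h t) x)
        ∂(gibbs α V)) t := by
  have htJ : t ∈ J := mem_of_mem_nhds hJ
  have hF := D.growth_grad_matS (a := a) (b := b) (c := c)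
  -- The exponents add up: v² from S, u v g from ∂_k L h and g from ∂_l h.
  have hF' : GrowthBound (sizeV V) (sizeΓ Γ) g J 1 3 2 (fun s x => ∑ k, ∑ l,
      matS a b c Γ (pos x) k l *
        (dgen α V Γ k (h s) x * pderiv l (h s) x + pderiv k (h s) x * dgen α V Γ l (h s) x)) :=
    GrowthBound.sum fun k _ => GrowthBound.sum fun l _ => (D.growth_matS k l).mul
      (((D.growth_dgen k).mul (D.growth_pderiv l)).add
        ((D.growth_pderiv k).mul (D.growth_dgen l)))
  obtain ⟨B, hB, hb⟩ := hF'.exists_integrable_bound one_le_sizeV one_le_sizeΓ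
    D.nonneg D.memLp_bound (by norm_num) (by norm_num)
  refine hasDerivAt_integral_of_dominated_loc_of_deriv_le (s := J)
    (F := fun s x => ∑ k, ∑ l, matS a b c Γ (pos x) k l * (pderiv k (h s) x * pderiv l (h s) x))
    (F' := fun s x => ∑ k, ∑ l, matS a b c Γ (pos x) k l *
        (dgen α V Γ k (h s) x * pderiv l (h s) x + pderiv k (h s) x * dgen α V Γ l (h s) x))
    (bound := B) hJ ?_ (D.integrable hF (by norm_num) (by norm_num) htJ) ?_
    (Eventually.of_forall fun x s hs => hb s hs x) hB ?_
  · filter_upwards [hJ] with s hs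
    exact (hF.cont s hs).aestronglyMeasurable
  · exact (hF'.cont t htJ).aestronglyMeasurable
  · refine Eventually.of_forall fun x s hs => ?_
    exact HasDerivAt.fun_sum fun k _ => HasDerivAt.fun_sum fun l _ =>
      ((hderiv s hs k x).mul (hderiv s hs l x)).const_mul _

end RegularData

end TimeDerivative

/-! ### Constant friction. -/

section ConstantFriction

variable {d : ℕ} {Γ : Pos d → Matrix (Fin d) (Fin d) ℝ}

theorem pderiv_const {ι : Type} [Fintype ι] [DecidableEq ι] {f : EuclideanSpace ℝ ι → ℝ}
    (hf : ∀ y y', f y = f y') (i : ι) (x : EuclideanSpace ℝ ι) : pderiv i f x = 0 := by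
  have : f = fun _ => f x := funext fun y => hf y x
  rw [this]
  simp [pderiv]

theorem matA_eq_zero (hΓ : ∀ q q', Γ q = Γ q') (h : Phase d → ℝ) (x : Phase d) :
    matA Γ h x = 0 := by
  have h0 : ∀ i, dGamma Γ i x = 0 := fun i => by
    ext j k
    exact pderiv_const (fun y y' => by rw [hΓ (pos y) (pos y')]) i x
  ext i j
  simp [matA, h0]

theorem matB_eq_zero (a b c : ℝ) (hΓ : ∀ q q', Γ q = Γ q') (h : Phase d → ℝ) (x : Phase d) :
    matB a b c Γ h x = 0 := by
  ext i j
  have h0 : ∀ k, pderiv (Sum.inl j) (fun y : Phase d => matS a b c Γ (pos y) i k) x = 0 :=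
    fun k => pderiv_const (fun y y' => by simp only [matS, hΓ (pos y) (pos y')]) _ x
  simp [matB, h0]

end ConstantFriction

end KineticLangevin

/-! ### The dissipation formula. -/

theorem mainTheorem3 {d : ℕ} (α a b c : ℝ) (hα : 0 < α) (ha : 0 < a) (hb : 0 < b) (hc : 0 < c)
    (V : KineticLangevin.Pos d → ℝ) (hV : ContDiff ℝ 2 V)
    (hZ : Integrable (KineticLangevin.gibbsWeight α V))
    (Γ : KineticLangevin.Pos d → Matrix (Fin d) (Fin d) ℝ)
    (hΓ : ∀ i j, ContDiff ℝ 1 (fun q => Γ q i j))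
    (hΓsymm : ∀ q, (Γ q).IsSymm) (hΓinv : ∀ q, IsUnit (Γ q).det)
    (hS : ∀ q, (KineticLangevin.matS a b c Γ q).PosSemidef)
    (I : Set ℝ) (hI : IsOpen I)
    (ρ : ℝ → KineticLangevin.Phase d → ℝ) (hρ : ∀ t ∈ I, ∀ x, 0 ≤ ρ t x)
    (hreg : KineticLangevin.IsRegularFamily α V Γ I
      (fun t => KineticLangevin.relDensity α V (ρ t)))
    (hFP : KineticLangevin.SolvesFokkerPlanck α V Γ I ρ)
    (t : ℝ) (ht : t ∈ I)
    (h : KineticLangevin.Phase d → ℝ) (hh : h = KineticLangevin.relDensity α V (ρ t)) :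
    -- the two integrals in the Lyapunov functional converge
    Integrable (fun x => (((KineticLangevin.lawOf (ρ t)).rnDeriv
        (KineticLangevin.gibbs α V) x).toReal - 1) ^ 2) (KineticLangevin.gibbs α V) ∧
    Integrable (fun x => KineticLangevin.grad h x ⬝ᵥ
        (KineticLangevin.matS a b c Γ (KineticLangevin.pos x) *ᵥ KineticLangevin.grad h x))
      (KineticLangevin.gibbs α V) ∧
    -- the formula for a general friction matrix
    (Integrable (KineticLangevin.rateIntegrand α a b c V Γ
        (fun q => KineticLangevin.hess V q * (b • ((Γ q)⁻¹ * (Γ q)⁻¹))) h)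
        (KineticLangevin.gibbs α V) ∧
      HasDerivAt (fun s => KineticLangevin.lyapunov α a b c V Γ (ρ s))
        (-2 * ∫ x, KineticLangevin.rateIntegrand α a b c V Γ
          (fun q => KineticLangevin.hess V q * (b • ((Γ q)⁻¹ * (Γ q)⁻¹))) h x
          ∂(KineticLangevin.gibbs α V)) t) ∧
    -- the order of the two factors in the mixed term is immaterial if they commute
    ((∀ q, Commute (Γ q) (KineticLangevin.hess V q)) →
      Integrable (KineticLangevin.rateIntegrand α a b c V Γ
        (fun q => (b • ((Γ q)⁻¹ * (Γ q)⁻¹)) * KineticLangevin.hess V q) h)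
        (KineticLangevin.gibbs α V) ∧
      HasDerivAt (fun s => KineticLangevin.lyapunov α a b c V Γ (ρ s))
        (-2 * ∫ x, KineticLangevin.rateIntegrand α a b c V Γ
          (fun q => (b • ((Γ q)⁻¹ * (Γ q)⁻¹)) * KineticLangevin.hess V q) h x
          ∂(KineticLangevin.gibbs α V)) t) ∧
    -- the correction matrices vanish if the friction matrix is constant
    ((∀ q q', Γ q = Γ q') →
      ∀ x, KineticLangevin.matA Γ h x = 0 ∧ KineticLangevin.matB a b c Γ h x = 0) := by
  have hα' : α ≠ 0 := hα.ne'
  obtain ⟨g, hg, hev⟩ := hreg.dominated t ht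
  -- One neighbourhood of t on which the equation holds and a single g dominates; all later
  -- estimates are uniform on it.
  obtain ⟨J, hJ, hJ'⟩ : ∃ J ∈ 𝓝 t, ∀ s ∈ J, s ∈ I ∧
      ∀ k ≤ 3, ∀ x, ‖iteratedFDeriv ℝ k (KineticLangevin.relDensity α V (ρ s)) x‖ ≤ g x :=
    ⟨_, inter_mem (hI.mem_nhds ht) hev, fun s hs => hs⟩
  have htJ : t ∈ J := mem_of_mem_nhds hJ
  have D : KineticLangevin.RegularData α V Γ g J
      (fun s => KineticLangevin.relDensity α V (ρ s)) :=
    { α_pos := hα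
      contDiff_V := hV
      integrable_weight := hZ
      contDiff_Γ := hΓ
      isUnit_det := hΓinv
      nonneg := fun x => (norm_nonneg _).trans ((hJ' t htJ).2 0 (by norm_num) x)
      memLp_bound := hg
      contDiff := fun s hs => hreg.contDiff s (hJ' s hs).1
      bound := fun s hs => (hJ' s hs).2 }
  have hrn : ∀ s ∈ J, ∀ᵐ x ∂(KineticLangevin.gibbs α V),
      (((KineticLangevin.lawOf (ρ s)).rnDeriv (KineticLangevin.gibbs α V) x).toReal - 1) ^ 2
        = (KineticLangevin.relDensity α V (ρ s) x - 1) ^ 2 := fun s hs => by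
    filter_upwards [KineticLangevin.rnDeriv_lawOf hV.continuous hZ (hρ s (hJ' s hs).1)
      (D.contDiff s hs).continuous] with x hx
    rw [hx]
  obtain ⟨hi1, hd1⟩ := D.hasDerivAt_integral_sub_one_sq
    (fun s hs x => KineticLangevin.hasDerivAt_relDensity hα' hV hZ hΓ hFP (hJ' s hs).1
      (D.contDiff s hs) x) hJ
  obtain ⟨hi2, hd2⟩ := D.hasDerivAt_integral_grad (a := a) (b := b) (c := c)
    (fun s hs k x => KineticLangevin.hasDerivAt_pderiv_relDensity hα' hV hZ hΓ hI hFP hreg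
      (hJ' s hs).1 k x) hJ
  obtain ⟨hi3, hz⟩ := D.isNullFun_rate (a := a) (b := b) (c := c) hΓsymm htJ
  have hmain : Integrable (KineticLangevin.rateIntegrand α a b c V Γ
        (fun q => KineticLangevin.hess V q * (b • ((Γ q)⁻¹ * (Γ q)⁻¹))) h)
        (KineticLangevin.gibbs α V) ∧
      HasDerivAt (fun s => KineticLangevin.lyapunov α a b c V Γ (ρ s))
        (-2 * ∫ x, KineticLangevin.rateIntegrand α a b c V Γ
          (fun q => KineticLangevin.hess V q * (b • ((Γ q)⁻¹ * (Γ q)⁻¹))) h x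
          ∂(KineticLangevin.gibbs α V)) t := by
    -- Integrability of the rate needs no separate estimate: it is half the difference of the null
    -- function and the two integrable time derivatives.
    have hir := ((hi3.sub (hi1.add hi2)).const_mul (1 / 2)).congr
      (g := KineticLangevin.rateIntegrand α a b c V Γ
        (fun q => KineticLangevin.hess V q * (b • ((Γ q)⁻¹ * (Γ q)⁻¹))) h)
      (Eventually.of_forall fun x => by simp only [hh, Pi.sub_apply, Pi.add_apply]; ring)
    refine ⟨hir, ?_⟩
    rw [hh] at hir ⊢
    have h12 := integral_add hi1 hi2
    have h123 := integral_add (hi1.add hi2) (hir.const_mul 2)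
    rw [integral_const_mul] at h123
    simp only [Pi.add_apply] at h123
    simp only [] at hz
    have hsum := hd1.add hd2
    refine HasDerivAt.congr_deriv (hsum.congr_of_eventuallyEq ?_) ?_
    -- The identification of the Radon–Nikodym derivative with h is available only for s in J, which
    -- suffices for a derivative at t.
    · filter_upwards [hJ] with s hs
      simp only [KineticLangevin.lyapunov, KineticLangevin.chiSqDiv, Pi.add_apply,
        KineticLangevin.grad_dotProduct_matS]
      rw [integral_congr_ae (hrn s hs)]
    · linarith [h12, h123.symm.trans hz]
  refine ⟨?_, ?_, hmain, fun hcomm => ?_, fun hconst x =>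
    ⟨KineticLangevin.matA_eq_zero hconst h x, KineticLangevin.matB_eq_zero a b c hconst h x⟩⟩
  · exact (D.integrable_sub_one_sq htJ).congr ((hrn t htJ).mono fun x hx => hx.symm)
  · simp only [hh, KineticLangevin.grad_dotProduct_matS]
    exact D.integrable D.growth_grad_matS (by norm_num) (by norm_num) htJ
  · have hK : (fun q => (b • ((Γ q)⁻¹ * (Γ q)⁻¹)) * KineticLangevin.hess V q)
        = fun q => KineticLangevin.hess V q * (b • ((Γ q)⁻¹ * (Γ q)⁻¹)) := by
      funext q
      -- If Γ commutes with Hess V then so do Γ⁻¹ and bΓ⁻², so both versions of the mixed term have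
      -- the same integrand.
      have h1 : Commute (Γ q)⁻¹ (KineticLangevin.hess V q) := by
        have h2 := hcomm q
        have hl : (Γ q)⁻¹ * Γ q = 1 := Matrix.nonsing_inv_mul _ (hΓinv q)
        have hr : Γ q * (Γ q)⁻¹ = 1 := Matrix.mul_nonsing_inv _ (hΓinv q)
        calc (Γ q)⁻¹ * KineticLangevin.hess V q
            = (Γ q)⁻¹ * (KineticLangevin.hess V q * Γ q) * (Γ q)⁻¹ := by
              rw [mul_assoc, mul_assoc, hr, mul_one]
          _ = KineticLangevin.hess V q * (Γ q)⁻¹ := by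
              rw [← h2.eq, ← mul_assoc, hl, one_mul]
      exact ((h1.mul_left h1).smul_left b).eq
    rw [hK]
    exact hmain
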